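/- Let $F_1,\dots,F_m$ be subsets of a finite set $E$ with union $E$, let $k\ge 0$ be an integer and let $\rho(F_i)\in\mathbb Z$ ($i\in[m]$). Write $F_I=\bigcup_{i\in I}F_i$, $\eta(F_i)=|F_i|-\rho(F_i)$ and $\nu(I)=|F_I|-\sum_{i\in I}\eta(F_i)$ for $I\subseteq[m]$. Assume $0\le\rho(F_i)\le|F_i|$ for all $i$, $k\le\nu([m])$, and $|F_I\cap F_j|<\rho(F_j)$ whenever $j\in[m]\setminus I$. (1) Gammoid. For $e\in E$ let $s(e)=\{i: e\in F_i\}$. Let $H$ consist of a vertex $u_e$ with label $h(u_e)=s(e)$ for every $e\in E$ with $|s(e)|\ge2$, and, for every $i\in[m]$, of $l_i=\rho(F_i)-|\{e: |s(e)|\ge 2,\ i\in s(e)\}|$ vertices with label $\{i\}$. Let $T=[k]$, and let $G$ be the directed graph on the disjoint union $E\sqcup H\sqcup T$ with arcs $e\to u$ for $e\in E$, $u\in H$ with $s(e)\subseteq h(u)$, and all arcs from $H$ to $T$. Then there is a matroid $M=M(F_1,\dots,F_m;k;\rho)$ on $E$ whose independent sets are the $X\subseteq E$ with $|X\cap F_I|\le\min\{\nu(I),k\}$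 for all $I\subseteq[m]$, and $M$ is the gammoid of $(G,E,T)$: a set $X\subseteq E$ is independent in $M$ if and only if $G$ has a set of $|X|$ vertex-disjoint paths from $X$ to $T$. (2) Cyclic flats and parameters. If moreover $\rho(F_i)<|F_i|$ for all $i$, then $M$ is the unique matroid on $E$ whose set of cyclic flats is $\{F_J:\nu(J)<k\}\cup\{E\}$ and whose rank function takes the value $\nu(J)$ on $F_J$ if $\nu(J)<k$, and the value $k$ on $E$. If in addition $k\ge1$ and $\max_i\rho(F_i)\le k$, then $M$ is an $(n,k,d,r,\delta)$-matroid with $n=|E|$, $d=n-k+1-\max\{\sum_{i\in I}\eta(F_i):\nu(I)<k\}$, $r=\max_i\rho(F_i)$ and $\delta=1+\min_i\eta(F_i)$. (3) Codes. There is $q_0$ such that for every finite field $K$ with $|K|\ge q_0$ there is a linear code $C\subseteq K^E$ which represents $M$, that is, $|C_X|=|K|^{\rho_M(X)}$ for the projection $C_X$ of $C$ to each $X\subseteq E$, where $\rho_M$ is the rank function of $M$; and whenever $M$ is an $(n,k,d,r,\delta)$-matroid, $C$ is a linear locally repairable code (LRC) with the same parameters $(n,k,d,r,\delta)$. Here a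 matroid with rank function $\rho_M$ on $E$ is an $(n,k,d,r,\delta)$-matroid if $n=|E|$, $k=\rho_M(E)$, $d=\min\{|X|:\rho_M(E\setminus X)<k\}$, $1\le r\le k$, $\delta\ge2$, and each $x\in E$ lies in a set $S\subseteq E$ with $|S|\le r+\delta-1$ such that $\rho_M(S\setminus X)=\rho_M(S)$ for all $X\subseteq S$ with $|X|<\delta$. A code $C\subseteq A^n$ over a finite alphabet $A$ is an $(n,k,d,r,\delta)$-LRC if $|C|=|A|^k$, $d=\min\{|X|:|C_{[n]\setminus X}|<|C|\}$, $1\le r\le k$, $\delta\ge 2$, and each coordinate lies in a set $S$ with $|S|\le r+\delta-1$ such that for all $l\in S$ and $L\subseteq S\setminus\{l\}$ with $|L|\ge|S|-(\delta-1)$ the symbol $c_l$ of a codeword $c\in C$ is a function of $(c_i)_{i\in L}$. -/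

import Mathlib

open Finset

universe u v w

noncomputable section

/-! ### Matroids: rank, cyclic flats, the parameters `(n, k, d, r, δ)` -/

/-- The rank of `X` in a matroid on a finite set, as a natural number. -/
def matroidRank {α : Type u} (M : Matroid α) (X : Set α) : ℕ := (M.eRk X).toNat

/-- A cyclic flat: a flat that is a (possibly empty) union of circuits. -/
def IsCyclicFlat {α : Type u} (M : Matroid α) (Z : Set α) : Prop :=
  M.IsFlat Z ∧ ∃ 𝒞 : Set (Set α), (∀ C ∈ 𝒞, M.IsCircuit C) ∧ Z = ⋃₀ 𝒞

/-- `S` is an `(r, δ)`-locality set of the matroid `M`: `|S| ≤ r + δ - 1`, and the minimum distance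
`min {|X| : X ⊆ S, ρ(S \ X) < ρ(S)}` of `M | S` is at least `δ`. -/
def IsMatroidLocalitySet {α : Type u} (M : Matroid α) (r δ : ℕ) (S : Set α) : Prop :=
  S ⊆ M.E ∧ S.ncard + 1 ≤ r + δ ∧
    ∀ X : Set α, X ⊆ S → matroidRank M (S \ X) < matroidRank M S → δ ≤ X.ncard

/-- `M` is an `(n, k, d, r, δ)`-matroid. -/
structure IsLRMatroid {α : Type u} (M : Matroid α) (n k d r δ : ℕ) : Prop where
  card_ground : M.E.ncard = n
  rank_ground : matroidRank M M.E = k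
  min_dist : IsLeast {t : ℕ | ∃ X : Set α, X ⊆ M.E ∧ matroidRank M (M.E \ X) < k ∧ t = X.ncard} d
  one_le_r : 1 ≤ r
  r_le : r ≤ k
  two_le_delta : 2 ≤ δ
  locality : ∀ x ∈ M.E, ∃ S : Set α, x ∈ S ∧ IsMatroidLocalitySet M r δ S

/-! ### Codes and locally repairable codes

Coordinates of a codeword are indexed by a finite type `ι`. -/

/-- The projection `C_X` of the code `C` to the coordinates in `X`. -/
def codeProj {ι : Type u} {A : Type v} (C : Set (ι → A)) (X : Set ι) : Set (X → A) :=
  (fun (c : ι → A) (i : X) => c i) '' C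

/-- `S` is an `(r, δ)`-locality set of the code `C`: `|S| ≤ r + δ - 1`, and for every `l ∈ S` and
every `L ⊆ S \ {l}` with `|L| ≥ |S| - (δ - 1)`, the symbol `c_l` of a codeword is a function of
the symbols `(c_i)_{i ∈ L}`. -/
def IsCodeLocalitySet {ι : Type u} {A : Type v} (C : Set (ι → A)) (r δ : ℕ) (S : Set ι) : Prop :=
  S.ncard + 1 ≤ r + δ ∧
    ∀ l ∈ S, ∀ L : Set ι, L ⊆ S \ {l} → S.ncard + 1 ≤ L.ncard + δ →
      ∀ c ∈ C, ∀ c' ∈ C, (∀ i ∈ L, c i = c' i) → c l = c' l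

/-- `C` is a locally repairable code with all-symbol locality and parameters `(n, k, d, r, δ)`. -/
structure IsLRC {ι : Type u} {A : Type v} (C : Set (ι → A)) (n k d r δ : ℕ) : Prop where
  length : Nat.card ι = n
  card_code : C.ncard = Nat.card A ^ k
  min_dist : IsLeast {t : ℕ | ∃ X : Set ι, (codeProj C Xᶜ).ncard < C.ncard ∧ t = X.ncard} d
  one_le_r : 1 ≤ r
  r_le : r ≤ k
  two_le_delta : 2 ≤ δ
  locality : ∀ j : ι, ∃ S : Set ι, j ∈ S ∧ IsCodeLocalitySet C r δ S

/-- The matroid of the code `C` is `M`: `|C_X| = |A| ^ ρ(X)` for every set `X` of coordinates. -/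
def CodeRepresents {ι : Type u} {A : Type v} (C : Set (ι → A)) (M : Matroid ι) : Prop :=
  M.E = Set.univ ∧
    ∀ X : Set ι, (codeProj C X).ncard = Nat.card A ^ matroidRank M X

/-! ### Gammoids -/

/-- The list `p` is the vertex sequence of a path of `G` from `X` to `T`. -/
def IsPathFromTo {V : Type u} (G : Digraph V) (X T : Set V) (p : List V) : Prop :=
  p.IsChain G.Adj ∧ (∃ x ∈ X, p.head? = some x) ∧ ∃ t ∈ T, p.getLast? = some t

/-- The independent sets of the gammoid of `(G, S, T)`: the sets `X ⊆ S` for which there is a set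
of `|X|` vertex-disjoint paths from `X` to `T`. -/
def gammoidIndepSets {V : Type u} (G : Digraph V) (S T : Set V) : Set (Set V) :=
  {X | X ⊆ S ∧ ∃ P : Set (List V), P.encard = X.encard ∧
    (∀ p ∈ P, IsPathFromTo G X T p) ∧ P.Pairwise List.Disjoint}

/-- `M` is the gammoid of `(G, S, T)`, where the ground set of `M` is identified with `S`
through `φ`. -/
def IsGammoidOf {α : Type u} {V : Type v} (M : Matroid α) (G : Digraph V) (S T : Set V)
    (φ : α → V) : Prop :=
  Set.BijOn φ M.E S ∧ ∀ X : Set α, X ⊆ M.E → (M.Indep X ↔ φ '' X ∈ gammoidIndepSets G S T)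

/-! ### The construction from `F₁, …, F_m`, `k` and `ρ`

`ρ i` stands for `ρ(F_i)`. -/

section construction

variable {E : Type u} [Fintype E] [DecidableEq E] {m : ℕ}

/-- `F_I = ⋃_{i ∈ I} F_i`. -/
def unionF (F : Fin m → Finset E) (I : Finset (Fin m)) : Finset E := I.biUnion F

/-- `|F_I| + ∑_{i ∈ I} (ρ(F_i) - |F_i|)`. -/
def nominalRank (F : Fin m → Finset E) (ρ : Fin m → ℤ) (I : Finset (Fin m)) : ℤ :=
  (#(unionF F I) : ℤ) + ∑ i ∈ I, (ρ i - (#(F i) : ℤ))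

/-- The family `𝒵 = {F_J : |F_J| + ∑_{i ∈ J} (ρ(F_i) - |F_i|) < k} ∪ {E}`. -/
def cyclicFlatFamily (F : Fin m → Finset E) (k : ℕ) (ρ : Fin m → ℤ) : Set (Set E) :=
  {Z | ∃ J : Finset (Fin m), nominalRank F ρ J < k ∧ Z = (unionF F J : Set E)} ∪ {Set.univ}

/-- `M` is a matroid on `E` whose set of cyclic flats is `𝒵`, and whose rank function takes the
prescribed values on `𝒵`. -/
def IsConstructedMatroid (F : Fin m → Finset E) (k : ℕ) (ρ : Fin m → ℤ) (M : Matroid E) : Prop :=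
  M.E = Set.univ ∧
  (∀ Z : Set E, IsCyclicFlat M Z ↔ Z ∈ cyclicFlatFamily F k ρ) ∧
  (∀ J : Finset (Fin m), nominalRank F ρ J < k →
    (matroidRank M (unionF F J : Set E) : ℤ) = nominalRank F ρ J) ∧
  matroidRank M Set.univ = k

/-- The family `ℐ = {X : |F_I ∩ X| ≤ ρ(F_I) for all I ⊆ [m]}`, where
`ρ(F_I) = min (|F_I| + ∑_{i ∈ I} (ρ(F_i) - |F_i|)) k`. -/
def constructionIndepSets (F : Fin m → Finset E) (k : ℕ) (ρ : Fin m → ℤ) : Set (Finset E) :=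
  {X | ∀ I : Finset (Fin m), (#(unionF F I ∩ X) : ℤ) ≤ min (nominalRank F ρ I) k}

/-- The values of `n`, `d`, `r`, `δ` of the constructed matroid:
`n = |E|`, `d = n - k + 1 - max {∑_{i ∈ I} η(F_i) : F_I ∈ 𝒵_{<k}}`, `r = max_i ρ(F_i)` and
`δ = 1 + min_i η(F_i)`, with `η(F_i) = |F_i| - ρ(F_i)`. -/
def AreConstructionParameters (F : Fin m → Finset E) (k : ℕ) (ρ : Fin m → ℤ) (n d r δ : ℕ) :
    Prop :=
  n = Fintype.card E ∧
  (∃ μ : ℤ, IsGreatest {t : ℤ | ∃ I : Finset (Fin m), nominalRank F ρ I < k ∧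
      t = ∑ i ∈ I, ((#(F i) : ℤ) - ρ i)} μ ∧ (d : ℤ) = (n : ℤ) - k + 1 - μ) ∧
  IsGreatest (Set.range ρ) (r : ℤ) ∧
  ∃ ν : ℤ, IsLeast (Set.range fun i => (#(F i) : ℤ) - ρ i) ν ∧ (δ : ℤ) = 1 + ν

/-! ### The directed graph computed from the same data -/

/-- The label `s(e) = {i : e ∈ F_i}`. -/
def elemLabel (F : Fin m → Finset E) (e : E) : Finset (Fin m) :=
  univ.filter fun i => e ∈ F i

/-- The number `l_i = ρ(F_i) - |{u ∈ H : i ∈ h(u)}|` of vertices `v^i_1, …, v^i_{l_i}`. When it is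
computed, the vertices `u ∈ H` with `i ∈ h(u)` are the `u_e` with `|s(e)| ≥ 2` and `i ∈ s(e)`. -/
def extraCount (F : Fin m → Finset E) (ρ : Fin m → ℤ) (i : Fin m) : ℕ :=
  (ρ i - (#(univ.filter fun e : E => 2 ≤ #(elemLabel F e) ∧ i ∈ elemLabel F e) : ℤ)).toNat

/-- The middle layer `H`: a vertex `u_e` for every `e` with `|s(e)| ≥ 2`, and vertices
`v^i_1, …, v^i_{l_i}` for every `i`. -/
abbrev MidVertex (F : Fin m → Finset E) (ρ : Fin m → ℤ) : Type u :=
  {e : E // 2 ≤ #(elemLabel F e)} ⊕ (Σ i : Fin m, Fin (extraCount F ρ i))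

/-- The function `h : H → 2^[m]` with `h(u_e) = s(e)` and `h(v^i_j) = {i}`. -/
def midLabel (F : Fin m → Finset E) (ρ : Fin m → ℤ) : MidVertex F ρ → Finset (Fin m)
  | .inl e => elemLabel F e.1
  | .inr v => {v.1}

/-- The vertex set `V = S ∪ H ∪ T` (a disjoint union) with `S = E` and `T = [k]`. -/
abbrev AlgVertex (F : Fin m → Finset E) (k : ℕ) (ρ : Fin m → ℤ) : Type u :=
  E ⊕ (MidVertex F ρ ⊕ Fin k)

/-- The directed graph on `V`: arcs `e → u` for `e ∈ S`, `u ∈ H` with `s(e) ⊆ h(u)`, and all arcs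
from `H` to `T`. -/
def algGraph (F : Fin m → Finset E) (k : ℕ) (ρ : Fin m → ℤ) : Digraph (AlgVertex F k ρ) where
  Adj x y := match x, y with
    | .inl e, .inr (.inl w) => elemLabel F e ⊆ midLabel F ρ w
    | .inr (.inl _), .inr (.inr _) => True
    | _, _ => False

/-- The embedding of `E` as the set `S` of sources. -/
def algSource (F : Fin m → Finset E) (k : ℕ) (ρ : Fin m → ℤ) : E → AlgVertex F k ρ := Sum.inl

/-- The set `T` of sinks. -/
def algSinks (F : Fin m → Finset E) (k : ℕ) (ρ : Fin m → ℤ) : Set (AlgVertex F k ρ) :=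
  Set.range fun t : Fin k => Sum.inr (Sum.inr t)

end construction

end

/-! Everything rests on reading ν(I) as a count: it is the number of vertices of `H` whose label
meets `I` (`nominalRank_eq_card_midMeet`). The strict intersection hypothesis makes every l_i
positive, so no truncation occurs in `extraCount`. The inequalities |X ∩ F_I| ≤ ν(I) then amount to
Hall's condition for matching `X` into `H` along s(e) ⊆ h(u), and the independent sets are the
matchable sets of at most `k` elements (`mem_constructionIndepSets_iff`).

Since `H` is completely joined to the `k` sinks, such matchings are exactly linkings into `T`, which
gives the gammoid. They are also the independent sets of generic vectors ∑ a(e,u) y_u with y_u ∈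
K^k: Hall's condition is necessary for any coefficients, and a nonvanishing polynomial makes it
sufficient (`exists_vectors_transversal`). Over ℚ this yields the matroid itself, and over large
finite fields the codes.

If ρ(F_i) < |F_i|, there is an injective section τ : H → E of the adjacency that spares one element
of label {i} for each `i` (`exists_section`). Images under τ of at most `k` vertices are
independent, so F_I has rank min(ν(I), k). Rerouting τ around an element of F_I shows that deleting
it costs no rank, so F_I is a union of circuits; extending τ to an element outside F_I shows that
F_I is a flat when ν(I) < k. Conversely, a circuit of rank below `k` violates some inequality, and
F_I for that `I` lies between the circuit and its closure (`exists_unionF_of_isCircuit`). Cyclic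
flats and their ranks determine a matroid, whence uniqueness; the minimum distance is computed from
the nullities of cyclic flats, and the locality from subsets of single F_i. -/

/-! ### Rank in a matroid on a finite type -/

section rank

variable {α : Type u}

lemma matroidRank_closure (M : Matroid α) (X : Set α) :
    matroidRank M (M.closure X) = matroidRank M X := by
  rw [matroidRank, matroidRank, M.eRk_closure_eq]

/-- The union of the circuits contained in a flat is a cyclic flat. -/
lemma isCyclicFlat_sUnion_circuits {M : Matroid α} {Y : Set α} (hY : M.IsFlat Y) :
    IsCyclicFlat M (⋃₀ {C | M.IsCircuit C ∧ C ⊆ Y}) := by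
  set Z := ⋃₀ {C | M.IsCircuit C ∧ C ⊆ Y} with hZ
  have hZY : Z ⊆ Y := Set.sUnion_subset fun C hC => hC.2
  have hZE : Z ⊆ M.E := hZY.trans hY.subset_ground
  refine ⟨?_, _, fun C hC => hC.1, hZ⟩
  rw [Matroid.isFlat_iff_closure_eq]
  refine (M.subset_closure Z hZE).antisymm' fun x hx => ?_
  by_contra hxZ
  -- This circuit stays inside the flat `Y`, so it is one of those making up `Z`.
  obtain ⟨C, hCs, hC, hxC⟩ := Matroid.exists_isCircuit_of_mem_closure hx hxZ
  have hxY : x ∈ Y := by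
    have := M.closure_subset_closure hZY hx
    rwa [hY.closure] at this
  exact hxZ ⟨C, ⟨hC, hCs.trans (Set.insert_subset hxY hZY)⟩, hxC⟩

/-- The union of the circuits inside the closure of `C` is itself closed and contains `C`, so it is
the whole closure. -/
lemma Matroid.IsCircuit.isCyclicFlat_closure {M : Matroid α} {C : Set α} (hC : M.IsCircuit C) :
    IsCyclicFlat M (M.closure C) := by
  have hfl := M.isFlat_closure C
  have h := isCyclicFlat_sUnion_circuits hfl
  suffices ⋃₀ {D | M.IsCircuit D ∧ D ⊆ M.closure C} = M.closure C by rwa [this] at h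
  refine (Set.sUnion_subset fun D hD => hD.2).antisymm ?_
  have hCs : C ⊆ ⋃₀ {D | M.IsCircuit D ∧ D ⊆ M.closure C} :=
    Set.subset_sUnion_of_mem (show C ∈ _ from ⟨hC, M.subset_closure C hC.subset_ground⟩)
  simpa [h.1.closure] using M.closure_subset_closure hCs

variable [_root_.Finite α] (M : Matroid α)

lemma cast_matroidRank (X : Set α) : (matroidRank M X : ℕ∞) = M.eRk X :=
  ENat.natCast_toNat ((M.eRk_le_encard X).trans_lt X.toFinite.encard_lt_top).ne

lemma matroidRank_mono {X Y : Set α} (h : X ⊆ Y) : matroidRank M X ≤ matroidRank M Y := by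
  have := M.eRk_mono h
  rw [← cast_matroidRank, ← cast_matroidRank] at this
  exact_mod_cast this

lemma Matroid.IsBasis.matroidRank_eq {M : Matroid α} {I X : Set α} (h : M.IsBasis I X) :
    matroidRank M X = I.ncard := by
  have := cast_matroidRank M X
  rw [← h.encard_eq_eRk, ← I.toFinite.cast_ncard_eq] at this
  exact_mod_cast this

lemma Matroid.Indep.matroidRank_eq {M : Matroid α} {I : Set α} (h : M.Indep I) :
    matroidRank M I = I.ncard :=
  h.isBasis_self.matroidRank_eq

lemma Matroid.Indep.ncard_le_matroidRank {M : Matroid α} {I X : Set α} (h : M.Indep I)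
    (hX : I ⊆ X) : I.ncard ≤ matroidRank M X :=
  h.matroidRank_eq ▸ matroidRank_mono M hX

lemma exists_indep_ncard_eq_matroidRank (X : Set α) :
    ∃ I, I ⊆ X ∧ M.Indep I ∧ I.ncard = matroidRank M X := by
  obtain ⟨I, hIX, hI, hc⟩ := Matroid.le_eRk_iff.1 (le_refl (M.eRk X))
  refine ⟨I, hIX, hI, ?_⟩
  rw [← cast_matroidRank, ← I.toFinite.cast_ncard_eq] at hc
  exact_mod_cast hc

lemma matroidRank_le_of_forall_indep {X : Set α} {t : ℕ}
    (h : ∀ I, I ⊆ X → M.Indep I → I.ncard ≤ t) : matroidRank M X ≤ t := by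
  obtain ⟨I, hIX, hI, hc⟩ := exists_indep_ncard_eq_matroidRank M X
  exact hc ▸ h I hIX hI

lemma Matroid.IsCircuit.matroidRank_add_one {M : Matroid α} {C : Set α} (h : M.IsCircuit C) :
    matroidRank M C + 1 = C.ncard := by
  have := h.eRk_add_one_eq
  rw [← cast_matroidRank, ← C.toFinite.cast_ncard_eq] at this
  exact_mod_cast this

/-- An element of `Y` outside the closure of `X` would raise the rank of `X` beyond that of `Y`. -/
lemma subset_closure_of_matroidRank_le {M : Matroid α} {X Y : Set α} (hY : Y ⊆ M.E) (hXY : X ⊆ Y)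
    (h : matroidRank M Y ≤ matroidRank M X) : Y ⊆ M.closure X := by
  intro e he
  by_contra hc
  have h1 := M.eRk_insert_eq_add_one (X := X) (e := e) ⟨hY he, hc⟩
  rw [← cast_matroidRank, ← cast_matroidRank] at h1
  have h2 := matroidRank_mono M (Set.insert_subset he hXY)
  have h3 : matroidRank M (insert e X) = matroidRank M X + 1 := by exact_mod_cast h1
  omega

lemma matroidRank_union_le (X Y : Set α) : matroidRank M (X ∪ Y) ≤ matroidRank M X + Y.ncard := by
  have := M.eRk_union_le_eRk_add_encard X Y
  rw [← cast_matroidRank, ← cast_matroidRank, ← Y.toFinite.cast_ncard_eq] at this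
  exact_mod_cast this

/-- The nullity of a flat is the nullity of the union of its circuits. -/
lemma ncard_add_matroidRank_sUnion_circuits_le {M : Matroid α} {Y : Set α} (hY : M.IsFlat Y) :
    Y.ncard + matroidRank M (⋃₀ {C | M.IsCircuit C ∧ C ⊆ Y}) ≤
      (⋃₀ {C | M.IsCircuit C ∧ C ⊆ Y}).ncard + matroidRank M Y := by
  set Z := ⋃₀ {C | M.IsCircuit C ∧ C ⊆ Y} with hZ
  have hZY : Z ⊆ Y := Set.sUnion_subset fun C hC => hC.2
  have hZE : Z ⊆ M.E := hZY.trans hY.subset_ground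
  obtain ⟨I, hI⟩ := M.exists_isBasis Z hZE
  obtain ⟨B, hB, hIB⟩ := hI.indep.subset_isBasis_of_subset (hI.subset.trans hZY) hY.subset_ground
  rw [hI.matroidRank_eq, hB.matroidRank_eq]
  -- An element of `Y` outside the basis `B` closes a circuit with elements of `B`; this circuit
  -- lies in `Y`, hence in `Z`.
  have hsub : Y \ B ⊆ Z \ I := by
    rintro x ⟨hxY, hxB⟩
    refine ⟨?_, fun h => hxB (hIB h)⟩
    obtain ⟨C, hCs, hC, hxC⟩ :=
      Matroid.exists_isCircuit_of_mem_closure (hB.subset_closure hxY) hxB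
    exact ⟨C, ⟨hC, hCs.trans (Set.insert_subset hxY hB.subset)⟩, hxC⟩
  have h1 := Set.ncard_le_ncard hsub (Set.toFinite _)
  have h2 := Set.ncard_sdiff_add_ncard_of_subset hB.subset (Set.toFinite _)
  have h3 := Set.ncard_sdiff_add_ncard_of_subset hI.subset (Set.toFinite _)
  omega

/-- A matroid on a finite set is determined by its cyclic flats and their ranks. -/
lemma indep_iff_forall_isCyclicFlat {M : Matroid α} {X : Set α} (hX : X ⊆ M.E) :
    M.Indep X ↔ ∀ Z, IsCyclicFlat M Z → (X ∩ Z).ncard ≤ matroidRank M Z := by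
  refine ⟨fun h Z _ => (h.inter_right Z).ncard_le_matroidRank Set.inter_subset_right, fun h => ?_⟩
  by_contra hXi
  -- The closure of `C` is a cyclic flat of rank |C| - 1 that meets `X` in at least |C| elements.
  obtain ⟨C, hCX, hC⟩ := ((Matroid.not_indep_iff hX).1 hXi).exists_isCircuit_subset
  have h1 := h _ hC.isCyclicFlat_closure
  have h2 : C ⊆ X ∩ M.closure C := Set.subset_inter hCX (M.subset_closure C hC.subset_ground)
  have h3 := Set.ncard_le_ncard h2 (Set.toFinite _)
  have h4 := hC.matroidRank_add_one
  rw [matroidRank_closure] at h1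
  omega

end rank

/-! ### Codes representing a matroid -/

section codes

variable {ι : Type u} {A : Type v}

lemma ncard_codeProj_univ (C : Set (ι → A)) : (codeProj C Set.univ).ncard = C.ncard := by
  refine Set.ncard_image_of_injective C fun c c' h => funext fun i => ?_
  exact congrFun h ⟨i, Set.mem_univ i⟩

/-- If the projections to `L ⊆ S` and to `S` have the same size, the symbols in `S` are determined
by those in `L`. -/
lemma eq_of_ncard_codeProj_le [Finite ι] [Finite A] {C : Set (ι → A)} {L S : Set ι} (hLS : L ⊆ S)
    (h : (codeProj C S).ncard ≤ (codeProj C L).ncard) {c c' : ι → A} (hc : c ∈ C) (hc' : c' ∈ C)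
    (heq : ∀ i ∈ L, c i = c' i) {l : ι} (hl : l ∈ S) : c l = c' l := by
  let g : (S → A) → (L → A) := fun x i => x ⟨i.1, hLS i.2⟩
  have himg : codeProj C L = g '' codeProj C S := by
    rw [codeProj, codeProj, Set.image_image]
  -- Restriction maps C_S onto C_L, so it is injective when C_L is not smaller.
  have hinj : Set.InjOn g (codeProj C S) :=
    Set.injOn_of_ncard_image_eq (le_antisymm (Set.ncard_image_le (Set.toFinite _)) (himg ▸ h))
      (Set.toFinite _)
  have := hinj ⟨c, hc, rfl⟩ ⟨c', hc', rfl⟩ (funext fun i => heq i.1 i.2)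
  exact congrFun this ⟨l, hl⟩

/-- A code representing an `(n, k, d, r, δ)`-matroid is an `(n, k, d, r, δ)`-LRC. -/
lemma CodeRepresents.isLRC [Finite ι] [Finite A] [Nontrivial A] {C : Set (ι → A)} {M : Matroid ι}
    (hCM : CodeRepresents C M) {n k d r δ : ℕ} (hM : IsLRMatroid M n k d r δ) :
    IsLRC C n k d r δ := by
  have hA : 1 < Nat.card A := Finite.one_lt_card
  have hcard : C.ncard = Nat.card A ^ k := by
    rw [← ncard_codeProj_univ, hCM.2, ← hM.rank_ground, hCM.1]
  refine ⟨?_, hcard, ?_, hM.one_le_r, hM.r_le, hM.two_le_delta, fun j => ?_⟩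
  · rw [← hM.card_ground, hCM.1, Set.ncard_univ]
  · convert hM.min_dist using 3 with t
    refine exists_congr fun X => ?_
    rw [hcard, hCM.2, Nat.pow_lt_pow_iff_right hA, hCM.1, ← Set.compl_eq_univ_sdiff]
    simp
  · obtain ⟨S, hjS, -, hS, hloc⟩ := hM.locality j (by simp [hCM.1])
    refine ⟨S, hjS, hS, fun l hl L hL hLc c hc c' hc' heq => ?_⟩
    have hLS : L ⊆ S := hL.trans Set.sdiff_subset
    refine eq_of_ncard_codeProj_le hLS ?_ hc hc' heq hl
    rw [hCM.2, hCM.2, Nat.pow_le_pow_iff_right hA]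
    by_contra! hlt
    -- If `L` had smaller rank than `S`, then |S \ L| ≥ δ, against |L| ≥ |S| - (δ - 1).
    have h1 := hloc (S \ L) Set.sdiff_subset (by rwa [Set.sdiff_sdiff_cancel_left hLS])
    have h2 := Set.ncard_sdiff_add_ncard_of_subset hLS (Set.toFinite _)
    omega

end codes

/-! ### Matroids and codes of a family of vectors -/

section vectors

/-- The independent sets of a family of vectors form a matroid. -/
lemma exists_matroid_of_vectors {E : Type u} [DecidableEq E] (K : Type v) [Field K] {V : Type w}
    [AddCommGroup V] [Module K V] (x : E → V) :
    ∃ M : Matroid E, M.E = Set.univ ∧ ∀ X : Finset E, M.Indep (X : Set E) ↔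
      LinearIndepOn K x (X : Set E) := by
  refine ⟨(IndepMatroid.ofFinset Set.univ (fun X => LinearIndepOn K x (X : Set E))
    (by simp) (fun I J hJ hIJ => hJ.mono (by exact_mod_cast hIJ)) ?_ (fun _ _ => Set.subset_univ _)
      ).matroid, rfl, fun X => ?_⟩
  swap
  · rw [IndepMatroid.matroid_Indep, IndepMatroid.ofFinset_indep]
  intro I J hI hJ hIJ
  -- Otherwise the span of `J` lies in that of `I`, and comparing dimensions gives |J| ≤ |I|.
  have hex : ∃ e ∈ J, x e ∉ Submodule.span K (x '' (I : Set E)) := by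
    by_contra! hc
    have hle : Submodule.span K (x '' (J : Set E)) ≤ Submodule.span K (x '' (I : Set E)) :=
      Submodule.span_le.2 (by rintro _ ⟨e, he, rfl⟩; exact hc e he)
    have hfin : FiniteDimensional K (Submodule.span K (x '' (I : Set E))) :=
      FiniteDimensional.span_of_finite K (I.finite_toSet.image x)
    have h1 := Submodule.finrank_mono hle
    have h2 : ∀ X : Finset E, LinearIndepOn K x (X : Set E) →
        Module.finrank K (Submodule.span K (x '' (X : Set E))) = #X := by
      intro X hX
      have := finrank_span_eq_card (R := K) (b := fun i : (X : Set E) => x i) hX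
      rw [Set.range_comp', Subtype.range_coe] at this
      simpa using this
    rw [h2 I hI, h2 J hJ] at h1
    omega
  obtain ⟨e, heJ, he⟩ := hex
  refine ⟨e, heJ, fun h => he (Submodule.subset_span ⟨e, h, rfl⟩), ?_⟩
  rw [Finset.coe_insert]
  exact hI.insert he

/-- The row space of a matrix represents the matroid of its columns. -/
lemma exists_code_of_vectors {E : Type u} [Finite E] {K : Type v} [Field K] [Finite K] {k : ℕ}
    (x : E → Fin k → K) {M : Matroid E} (hME : M.E = Set.univ)
    (hM : ∀ X : Finset E, M.Indep (X : Set E) ↔ LinearIndepOn K x (X : Set E)) :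
    ∃ C : Submodule K (E → K), CodeRepresents (C : Set (E → K)) M := by
  classical
  have := Fintype.ofFinite E
  refine ⟨LinearMap.range (Matrix.mulVecLin (Matrix.of x)), hME, fun X => ?_⟩
  -- The coordinate at `e` of a codeword is the dot product with `x e`, so projecting to `X` keeps
  -- the matrix rows indexed by `X`. The dimension of C_X is the row rank of that submatrix.
  have hproj : codeProj ((LinearMap.range (Matrix.mulVecLin (Matrix.of x)) :
      Submodule K (E → K)) : Set (E → K)) X =
      (LinearMap.range (Matrix.mulVecLin (Matrix.of fun i : X => x i)) : Submodule K (X → K)) := by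
    ext c
    simp only [codeProj, Set.mem_image, SetLike.mem_coe, LinearMap.mem_range]
    constructor
    · rintro ⟨_, ⟨y, rfl⟩, rfl⟩
      exact ⟨y, rfl⟩
    · rintro ⟨y, rfl⟩
      exact ⟨_, ⟨y, rfl⟩, rfl⟩
  rw [hproj]
  change Nat.card (LinearMap.range (Matrix.mulVecLin (Matrix.of fun i : X => x i))) = _
  rw [Module.natCard_eq_pow_finrank (K := K)]
  congr 1
  change (Matrix.of fun i : X => x i).rank = _
  rw [Matrix.rank_eq_finrank_span_row]
  have hrow : Set.range (Matrix.of fun i : X => x i).row = x '' X := by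
    exact (Set.image_eq_range x X).symm
  rw [hrow]
  obtain ⟨I, hI⟩ := M.exists_isBasis X (by simp [hME])
  rw [hI.matroidRank_eq]
  have hIind : LinearIndepOn K x I := by
    have := (hM I.toFinite.toFinset).1 (by simpa using hI.indep)
    simpa using this
  have hspan : Submodule.span K (x '' X) = Submodule.span K (x '' I) := by
    refine le_antisymm (Submodule.span_le.2 ?_) (Submodule.span_mono (Set.image_mono hI.subset))
    rintro _ ⟨e, he, rfl⟩
    by_contra hc
    have h1 : LinearIndepOn K x (insert e I) := hIind.insert hc
    have h2 : M.Indep (insert e I) := by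
      have := (hM (insert e I).toFinite.toFinset).2 (by simpa using h1)
      simpa using this
    exact hc (Submodule.subset_span ⟨e, hI.mem_of_insert_indep he h2, rfl⟩)
  rw [hspan]
  have := finrank_span_eq_card (R := K) (b := fun i : I => x i) hIind
  rw [Set.range_comp', Subtype.range_coe] at this
  rw [this, ← Nat.card_eq_fintype_card]
  rfl

end vectors

/-! ### Generic representation of truncated transversal matroids -/

section generic

variable {E : Type u} {H : Type v} {k : ℕ} {R : Type w}

/-- The vectors `∑ u ∈ t e, a (e, u) • (a (u, j))_j` with coefficients given by `a`. -/
def transversalVec [CommRing R] (t : E → Finset H) (a : (E × H) ⊕ (H × Fin k) → R) (e : E)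
    (j : Fin k) : R :=
  ∑ u ∈ t e, a (.inl (e, u)) * a (.inr (u, j))

/-- For any coefficients, the vectors of a subset `Y` lie in the span of the y_u with `u` adjacent
to `Y`, so independence forces Hall's condition. The bound `k` is the dimension of the ambient
space. -/
lemma card_le_and_exists_matching_of_linearIndepOn {K : Type w} [Field K] (t : E → Finset H)
    (a : (E × H) ⊕ (H × Fin k) → K) {X : Finset E}
    (hX : LinearIndepOn K (transversalVec t a) (X : Set E)) :
    #X ≤ k ∧ ∃ f : X → H, Function.Injective f ∧ ∀ e : X, f e ∈ t e := by
  classical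
  have hX' : LinearIndependent K fun e : X => transversalVec t a e := hX
  refine ⟨by simpa using hX'.fintype_card_le_finrank, ?_⟩
  rw [← Finset.all_card_le_biUnion_card_iff_exists_injective fun e : X => t e]
  intro Y
  let y : H → Fin k → K := fun u j => a (.inr (u, j))
  have hY : LinearIndependent K fun e : Y => transversalVec t a e.1.1 :=
    hX'.comp (fun e : Y => e.1) Subtype.val_injective
  have hspan : Set.range (fun e : Y => transversalVec t a e.1.1) ≤
      Submodule.span K (((Y.biUnion fun e => t e.1).image y : Finset _) : Set (Fin k → K)) := by
    rintro _ ⟨e, rfl⟩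
    have : transversalVec t a e.1.1 = ∑ u ∈ t e.1.1, a (.inl (e.1.1, u)) • y u := by
      ext j
      simp [transversalVec, y]
    simp only [this]
    refine Submodule.sum_mem _ fun u hu => Submodule.smul_mem _ _ (Submodule.subset_span ?_)
    exact mem_coe.2 (mem_image_of_mem y (mem_biUnion.2 ⟨e.1, e.2, hu⟩))
  have h1 := linearIndependent_le_span_aux' _ hY _ hspan
  simp only [Fintype.card_coe, Finset.coe_sort_coe] at h1
  exact h1.trans card_image_le

/-- A polynomial that does not vanish only at coefficients for which the vectors in a matchable
set of at most `k` elements are independent. -/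
lemma exists_polynomial_linearIndepOn (t : E → Finset H) {X : Finset E} (hk : #X ≤ k)
    (hf : ∃ f : X → H, Function.Injective f ∧ ∀ e : X, f e ∈ t e) :
    ∃ P : MvPolynomial ((E × H) ⊕ (H × Fin k)) ℤ, ∀ (K : Type w) [Field K],
      MvPolynomial.map (Int.castRingHom K) P ≠ 0 ∧
      ∀ a : (E × H) ⊕ (H × Fin k) → K, MvPolynomial.aeval a P ≠ 0 →
        LinearIndepOn K (transversalVec t a) (X : Set E) := by
  classical
  obtain ⟨f, hf, hft⟩ := hf
  obtain ⟨g⟩ : Nonempty (X ↪ Fin k) := Function.Embedding.nonempty_of_card_le (by simpa using hk)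
  -- A maximal minor of the generic matrix, with columns selected by `g`. Integer coefficients let
  -- one polynomial serve all fields.
  let P : MvPolynomial ((E × H) ⊕ (H × Fin k)) ℤ :=
    (Matrix.of fun e e' : X => transversalVec t MvPolynomial.X e.1 (g e')).det
  have hP : ∀ (K : Type w) [Field K] (a : (E × H) ⊕ (H × Fin k) → K),
      MvPolynomial.aeval a P = (Matrix.of fun e e' : X => transversalVec t a e.1 (g e')).det := by
    intro K _ a
    rw [AlgHom.map_det]
    congr 1
    ext e e'
    simp [transversalVec]
  refine ⟨P, fun K _ => ⟨fun h0 => ?_, fun a ha => ?_⟩⟩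
  -- The indicators of the matchings `f` and `g` turn the minor into the identity matrix, so `P` is
  -- nonzero over every field.
  · let a : (E × H) ⊕ (H × Fin k) → K := Sum.elim
      (fun p => if ∃ e : X, e.1 = p.1 ∧ f e = p.2 then 1 else 0)
      (fun p => if ∃ e : X, f e = p.1 ∧ g e = p.2 then 1 else 0)
    have h1 : (Matrix.of fun e e' : X => transversalVec t a e.1 (g e')) = 1 := by
      ext e e'
      simp only [Matrix.of_apply, transversalVec]
      rw [Finset.sum_eq_single (f e)]
      · have h2 : a (.inl (e.1, f e)) = 1 := by
          simp only [a, Sum.elim_inl]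
          exact if_pos ⟨e, rfl, rfl⟩
        rw [h2, one_mul, Matrix.one_apply]
        simp only [a, Sum.elim_inr]
        congr 1
        simp only [eq_iff_iff]
        constructor
        · rintro ⟨c, hc, hc'⟩
          exact (hf hc).symm.trans (g.injective hc')
        · rintro rfl
          exact ⟨e, rfl, rfl⟩
      · intro u _ hu
        have h2 : a (.inl (e.1, u)) = 0 := by
          simp only [a, Sum.elim_inl]
          refine if_neg ?_
          rintro ⟨c, hc, rfl⟩
          exact hu (congrArg f (Subtype.ext hc))
        rw [h2, zero_mul]
      · exact fun h => absurd (hft e) h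
    have h2 := hP K a
    rw [h1, Matrix.det_one, MvPolynomial.aeval_def, ← MvPolynomial.eval_map] at h2
    rw [show algebraMap ℤ K = Int.castRingHom K from rfl, h0, map_zero] at h2
    exact zero_ne_one h2
  · rw [hP] at ha
    have h1 := Matrix.linearIndependent_rows_of_det_ne_zero ha
    exact LinearIndependent.of_comp (LinearMap.funLeft K K g) h1

/-- The sets of at most `k` elements that can be matched into a finite set are the independent sets
of vectors over every field with sufficiently many elements. -/
theorem exists_vectors_transversal [Finite E] [Finite H] (t : E → Finset H) (k : ℕ) :
    ∃ D : ℕ, ∀ (K : Type w) [Field K] (S : Finset K), D < #S →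
      ∃ x : E → Fin k → K, ∀ X : Finset E, LinearIndepOn K x (X : Set E) ↔
        #X ≤ k ∧ ∃ f : X → H, Function.Injective f ∧ ∀ e : X, f e ∈ t e := by
  classical
  have := Fintype.ofFinite E
  have := Fintype.ofFinite H
  have hP : ∀ X : Finset E, ∃ P : MvPolynomial ((E × H) ⊕ (H × Fin k)) ℤ,
      ∀ (K : Type w) [Field K], MvPolynomial.map (Int.castRingHom K) P ≠ 0 ∧
        ((#X ≤ k ∧ ∃ f : X → H, Function.Injective f ∧ ∀ e : X, f e ∈ t e) →
          ∀ a : (E × H) ⊕ (H × Fin k) → K, MvPolynomial.aeval a P ≠ 0 →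
            LinearIndepOn K (transversalVec t a) (X : Set E)) := by
    intro X
    by_cases hX : #X ≤ k ∧ ∃ f : X → H, Function.Injective f ∧ ∀ e : X, f e ∈ t e
    · obtain ⟨P, hP⟩ := exists_polynomial_linearIndepOn t hX.1 hX.2
      exact ⟨P, fun K _ => ⟨(hP K).1, fun _ => (hP K).2⟩⟩
    -- Sets that cannot be matched impose no condition; the constant 1 does not affect the product.
    · exact ⟨1, fun K _ => ⟨by simp, fun h => absurd h hX⟩⟩
  choose P hP using hP
  refine ⟨(∏ X, P X).totalDegree, fun K _ S hS => ?_⟩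
  let Q : MvPolynomial ((E × H) ⊕ (H × Fin k)) K := MvPolynomial.map (Int.castRingHom K) (∏ X, P X)
  have hQ : Q ≠ 0 := by
    simp only [Q, map_prod]
    exact prod_ne_zero_iff.2 fun X _ => (hP X K).1
  -- A nonzero polynomial cannot vanish on a grid whose sides exceed its degree in each variable;
  -- passing from ℤ to `K` does not raise the degree.
  obtain ⟨a, ha⟩ : ∃ a, MvPolynomial.eval a Q ≠ 0 := by
    by_contra! hc
    refine hQ (MvPolynomial.eq_zero_of_eval_zero_at_prod_finset Q (fun _ => S) (fun i => ?_)
      fun a _ => hc a)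
    refine lt_of_le_of_lt ?_ hS
    refine (MvPolynomial.degreeOf_le_totalDegree _ _).trans ?_
    exact Finset.sup_mono (MvPolynomial.support_map_subset _ _)
  simp only [Q, map_prod, prod_ne_zero_iff] at ha
  refine ⟨transversalVec t a, fun X =>
    ⟨card_le_and_exists_matching_of_linearIndepOn t a, fun h => ?_⟩⟩
  refine (hP X K).2 h a ?_
  have := ha X (mem_univ X)
  rwa [MvPolynomial.eval_map] at this

end generic

/-! ### Combinatorics of the construction -/

section construction

variable {E : Type u} [DecidableEq E] {m : ℕ} {F : Fin m → Finset E} {k : ℕ} {ρ : Fin m → ℤ}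

lemma mem_elemLabel {e : E} {i : Fin m} : i ∈ elemLabel F e ↔ e ∈ F i := by
  simp [elemLabel]

lemma mem_unionF {e : E} {I : Finset (Fin m)} : e ∈ unionF F I ↔ ∃ i ∈ I, e ∈ F i := by
  simp [unionF]

variable [Fintype E]

/-- The elements with label `{i}`. -/
def soleElems (F : Fin m → Finset E) (i : Fin m) : Finset E :=
  univ.filter fun e => elemLabel F e = {i}

/-- The vertices of the middle layer whose label meets `I`. -/
def midMeet (F : Fin m → Finset E) (ρ : Fin m → ℤ) (I : Finset (Fin m)) :
    Finset (MidVertex F ρ) :=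
  univ.filter fun u => ∃ i ∈ I, i ∈ midLabel F ρ u

lemma mem_soleElems {e : E} {i : Fin m} : e ∈ soleElems F i ↔ elemLabel F e = {i} := by
  simp [soleElems]

lemma mem_midMeet {u : MidVertex F ρ} {I : Finset (Fin m)} :
    u ∈ midMeet F ρ I ↔ ∃ i ∈ I, i ∈ midLabel F ρ u := by
  simp [midMeet]

lemma mem_of_mem_soleElems {e : E} {i : Fin m} (h : e ∈ soleElems F i) : e ∈ F i := by
  rw [← mem_elemLabel, mem_soleElems.1 h]
  exact mem_singleton_self i

lemma midMeet_mono {I J : Finset (Fin m)} (h : I ⊆ J) : midMeet F ρ I ⊆ midMeet F ρ J := by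
  intro u hu
  obtain ⟨i, hi, hu⟩ := mem_midMeet.1 hu
  exact mem_midMeet.2 ⟨i, h hi, hu⟩

/-- Splits F_I into repeated elements and elements with a single label. `card_midMeet` has the same
first summand, so ν(I) and the count in `H` need only be compared index by index. -/
lemma card_unionF_eq (I : Finset (Fin m)) :
    #(unionF F I) = #(univ.filter fun e : E => 2 ≤ #(elemLabel F e) ∧ ∃ i ∈ I, e ∈ F i) +
      ∑ i ∈ I, #(soleElems F i) := by
  rw [← card_biUnion]
  · rw [← card_union_of_disjoint]
    · congr 1
      ext e
      simp only [mem_unionF, mem_union, mem_filter, mem_univ, true_and, mem_biUnion]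
      constructor
      · rintro ⟨i, hi, he⟩
        by_cases h2 : 2 ≤ #(elemLabel F e)
        · exact .inl ⟨h2, i, hi, he⟩
        · refine .inr ⟨i, hi, mem_soleElems.2 ?_⟩
          have h1 : i ∈ elemLabel F e := mem_elemLabel.2 he
          refine (eq_of_subset_of_card_le (singleton_subset_iff.2 h1) ?_).symm
          rw [card_singleton]
          omega
      · rintro (⟨-, h⟩ | ⟨i, hi, h⟩)
        · exact h
        · exact ⟨i, hi, mem_of_mem_soleElems h⟩
    · rw [disjoint_left]
      intro e he he'
      obtain ⟨i, -, h⟩ := mem_biUnion.1 he'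
      have := (mem_filter.1 he).2.1
      rw [mem_soleElems.1 h, card_singleton] at this
      omega
  · intro i _ j _ hij
    refine disjoint_left.2 fun e he he' => hij ?_
    rw [mem_soleElems] at he he'
    exact singleton_injective (he.symm.trans he')

lemma card_eq_card_filter_add_card_soleElems (i : Fin m) :
    #(F i) = #(univ.filter fun e : E => 2 ≤ #(elemLabel F e) ∧ i ∈ elemLabel F e) +
      #(soleElems F i) := by
  have := card_unionF_eq (F := F) {i}
  simpa [unionF, mem_elemLabel] using this

lemma card_midMeet (I : Finset (Fin m)) :
    #(midMeet F ρ I) = #(univ.filter fun e : E => 2 ≤ #(elemLabel F e) ∧ ∃ i ∈ I, e ∈ F i) +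
      ∑ i ∈ I, extraCount F ρ i := by
  rw [midMeet, card_filter, Fintype.sum_sum_type, Fintype.sum_sigma]
  congr 1
  · rw [← card_filter, ← Fintype.card_subtype, ← Fintype.card_subtype]
    refine Fintype.card_congr ((Equiv.subtypeSubtypeEquivSubtypeInter _
      fun e => ∃ i ∈ I, i ∈ elemLabel F e).trans (Equiv.subtypeEquivRight fun e => ?_))
    simp [mem_elemLabel]
  · simp [midLabel]

/-- The repeated elements of F_i lie in the union of the other F_j, so `h_inter` for all indices but
`i` bounds their number strictly below `ρ i`. Thus `toNat` does not truncate and l_i ≥ 1. -/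
lemma cast_extraCount
    (h_inter : ∀ (I : Finset (Fin m)) (j : Fin m), j ∉ I → (#(unionF F I ∩ F j) : ℤ) < ρ j)
    (i : Fin m) : (#(univ.filter fun e : E => 2 ≤ #(elemLabel F e) ∧ i ∈ elemLabel F e) : ℤ) < ρ i ∧
      (extraCount F ρ i : ℤ) =
        ρ i - #(univ.filter fun e : E => 2 ≤ #(elemLabel F e) ∧ i ∈ elemLabel F e) := by
  have hlt : (#(univ.filter fun e : E => 2 ≤ #(elemLabel F e) ∧ i ∈ elemLabel F e) : ℤ) < ρ i := by
    refine lt_of_le_of_lt ?_ (h_inter (univ.erase i) i (notMem_erase i univ))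
    refine Nat.cast_le.2 (card_le_card fun e he => ?_)
    obtain ⟨h2, hi⟩ := (mem_filter.1 he).2
    obtain ⟨j, hj, hji⟩ := exists_mem_ne h2 i
    exact mem_inter.2 ⟨mem_unionF.2 ⟨j, by simpa using hji, mem_elemLabel.1 hj⟩,
      mem_elemLabel.1 hi⟩
  exact ⟨hlt, Int.toNat_of_nonneg (by omega)⟩

/-- The nominal rank counts the vertices of the middle layer whose label meets `I`. -/
lemma nominalRank_eq_card_midMeet
    (h_inter : ∀ (I : Finset (Fin m)) (j : Fin m), j ∉ I → (#(unionF F I ∩ F j) : ℤ) < ρ j)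
    (I : Finset (Fin m)) : nominalRank F ρ I = #(midMeet F ρ I) := by
  rw [nominalRank, card_unionF_eq, card_midMeet]
  push_cast
  rw [add_assoc, ← sum_add_distrib]
  congr 1
  refine sum_congr rfl fun i _ => ?_
  have h := card_eq_card_filter_add_card_soleElems (F := F) i
  rw [(cast_extraCount h_inter i).2]
  omega

/-- The adjacency of the sources with the middle layer. -/
def midNeighbors (F : Fin m → Finset E) (ρ : Fin m → ℤ) (e : E) : Finset (MidVertex F ρ) :=
  univ.filter fun u => elemLabel F e ⊆ midLabel F ρ u

lemma mem_midNeighbors {e : E} {u : MidVertex F ρ} :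
    u ∈ midNeighbors F ρ e ↔ elemLabel F e ⊆ midLabel F ρ u := by
  simp [midNeighbors]

/-- The prescribed independent sets are the sets of at most `k` elements that can be matched into
the middle layer. -/
lemma mem_constructionIndepSets_iff
    (h_union : unionF F Finset.univ = Finset.univ)
    (h_inter : ∀ (I : Finset (Fin m)) (j : Fin m), j ∉ I → (#(unionF F I ∩ F j) : ℤ) < ρ j)
    (X : Finset E) : X ∈ constructionIndepSets F k ρ ↔
      #X ≤ k ∧ ∃ f : X → MidVertex F ρ, Function.Injective f ∧
        ∀ e : X, f e ∈ midNeighbors F ρ e := by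
  simp only [constructionIndepSets, Set.mem_ofPred_eq, nominalRank_eq_card_midMeet h_inter,
    ← Nat.cast_min, Nat.cast_le, le_min_iff]
  constructor
  · intro h
    refine ⟨by simpa [h_union] using (h univ).2, ?_⟩
    rw [← Finset.all_card_le_biUnion_card_iff_exists_injective fun e : X => midNeighbors F ρ e]
    intro Y
    -- With this `I`, all of `midMeet F ρ I` is adjacent to `Y`, which pays for the part of `Y` in
    -- F_I. Every other `e` in `Y` is repeated and has its own neighbour u_e outside `midMeet F ρ
    -- I`.
    set I : Finset (Fin m) := univ.filter fun i => ∃ e ∈ Y, e.1 ∈ soleElems F i with hI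
    set Y₁ := Y.filter fun e => e.1 ∈ unionF F I with hY₁
    set Y₂ := Y.filter fun e => e.1 ∉ unionF F I with hY₂
    have hY : #Y₁ + #Y₂ = #Y := card_filter_add_card_filter_not _
    have h1 : #Y₁ ≤ #(midMeet F ρ I) := by
      refine le_trans ?_ (h I).1
      refine card_le_card_of_injOn Subtype.val (fun e he => ?_) Subtype.val_injective.injOn
      exact mem_coe.2 (mem_inter.2 ⟨(mem_filter.1 he).2, e.2⟩)
    have h2 : ∀ e ∈ Y₂, 2 ≤ #(elemLabel F e.1) := by
      intro e he
      by_contra hlt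
      obtain ⟨i, -, hi⟩ : ∃ i ∈ univ, e.1 ∈ F i := by rw [← mem_unionF, h_union]; exact mem_univ _
      refine (mem_filter.1 he).2 (mem_unionF.2 ⟨i, ?_, hi⟩)
      refine mem_filter.2 ⟨mem_univ _, e, (mem_filter.1 he).1, mem_soleElems.2 ?_⟩
      refine (eq_of_subset_of_card_le (singleton_subset_iff.2 (mem_elemLabel.2 hi)) ?_).symm
      rw [card_singleton]
      omega
    let g : Y₂ → MidVertex F ρ := fun e => .inl ⟨e.1.1, h2 e.1 e.2⟩
    have hg : Function.Injective g := by
      intro e e' hee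
      have := congrArg Subtype.val (Sum.inl_injective hee)
      exact Subtype.ext (Subtype.ext this)
    have hdisj : Disjoint (midMeet F ρ I) (univ.image g) := by
      rw [disjoint_left]
      intro u hu hu'
      obtain ⟨e, -, rfl⟩ := mem_image.1 hu'
      obtain ⟨i, hi, hie⟩ := mem_midMeet.1 hu
      exact (mem_filter.1 e.2).2 (mem_unionF.2 ⟨i, hi, mem_elemLabel.1 hie⟩)
    have hsub : midMeet F ρ I ∪ univ.image g ⊆ Y.biUnion fun e : X => midNeighbors F ρ e := by
      refine union_subset (fun u hu => ?_) (fun u hu => ?_)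
      · obtain ⟨i, hi, hu⟩ := mem_midMeet.1 hu
        obtain ⟨e, he, hei⟩ := (mem_filter.1 hi).2
        refine mem_biUnion.2 ⟨e, he, mem_midNeighbors.2 ?_⟩
        rw [mem_soleElems.1 hei]
        exact singleton_subset_iff.2 hu
      · obtain ⟨e, -, rfl⟩ := mem_image.1 hu
        exact mem_biUnion.2 ⟨e.1, (mem_filter.1 e.2).1, mem_midNeighbors.2 Subset.rfl⟩
    have h3 := card_le_card hsub
    rw [card_union_of_disjoint hdisj, card_image_of_injective _ hg, card_univ,
      Fintype.card_coe] at h3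
    omega
  · rintro ⟨hk, f, hf, hft⟩ I
    refine ⟨?_, (card_le_card inter_subset_right).trans hk⟩
    rw [← card_attach]
    refine card_le_card_of_injOn (fun e => f ⟨e.1, (mem_inter.1 e.2).2⟩) (fun e _ => ?_) ?_
    · obtain ⟨i, hi, hie⟩ := mem_unionF.1 (mem_inter.1 e.2).1
      exact mem_coe.2 (mem_midMeet.2 ⟨i, hi, mem_midNeighbors.1 (hft _) (mem_elemLabel.2 hie)⟩)
    · intro e _ e' _ hee
      exact Subtype.ext (congrArg (fun e : X => e.1) (hf hee))

/-- A subset of `F i` with at most `ρ i` elements is independent. -/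
lemma mem_constructionIndepSets_of_subset
    (h_inter : ∀ (I : Finset (Fin m)) (j : Fin m), j ∉ I → (#(unionF F I ∩ F j) : ℤ) < ρ j)
    {i : Fin m} (hi : ρ i ≤ k) {Y : Finset E} (hY : Y ⊆ F i) (hYc : (#Y : ℤ) ≤ ρ i) :
    Y ∈ constructionIndepSets F k ρ := by
  intro I
  have hle : (#(unionF F I ∩ Y) : ℤ) ≤ #Y := Nat.cast_le.2 (card_le_card inter_subset_right)
  refine le_min ?_ (by omega)
  have hsing : nominalRank F ρ {i} = ρ i := by simp [nominalRank, unionF]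
  have hmono : ∀ J, i ∈ J → ρ i ≤ nominalRank F ρ J := by
    intro J hJ
    rw [← hsing, nominalRank_eq_card_midMeet h_inter, nominalRank_eq_card_midMeet h_inter]
    exact Nat.cast_le.2 (card_le_card (midMeet_mono (singleton_subset_iff.2 hJ)))
  by_cases hiI : i ∈ I
  · exact hle.trans (hYc.trans (hmono I hiI))
  -- Here ν(I ∪ {i}) = ν(I) + ρ(F_i) - |F_i ∩ F_I|, so ν(I ∪ {i}) ≥ ρ(F_i) gives ν(I) ≥ |F_i ∩ F_I|.
  · have h1 := hmono _ (mem_insert_self i I)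
    have h2 : (#(unionF F I ∩ Y) : ℤ) ≤ #(F i ∩ unionF F I) := by
      rw [inter_comm]
      exact Nat.cast_le.2 (card_le_card (inter_subset_inter hY Subset.rfl))
    have h3 := card_union_add_card_inter (F i) (unionF F I)
    rw [nominalRank, sum_insert hiI, unionF, biUnion_insert, ← unionF] at h1
    rw [nominalRank]
    omega

/-- A partial section of the adjacency has an independent image. -/
lemma image_mem_constructionIndepSets
    (h_union : unionF F Finset.univ = Finset.univ)
    (h_inter : ∀ (I : Finset (Fin m)) (j : Fin m), j ∉ I → (#(unionF F I ∩ F j) : ℤ) < ρ j)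
    {τ : MidVertex F ρ → E} {U : Finset (MidVertex F ρ)}
    (hτ : ∀ u ∈ U, elemLabel F (τ u) ⊆ midLabel F ρ u) (hU : #U ≤ k) :
    U.image τ ∈ constructionIndepSets F k ρ := by
  rw [mem_constructionIndepSets_iff h_union h_inter]
  refine ⟨card_image_le.trans hU, ?_⟩
  have h : ∀ e : U.image τ, ∃ u ∈ U, τ u = e.1 := fun e => mem_image.1 e.2
  choose f hfU hf using h
  refine ⟨f, fun e e' hee => Subtype.ext ?_, fun e => mem_midNeighbors.2 ?_⟩
  · rw [← hf e, ← hf e', hee]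
  · conv_lhs => rw [← hf e]
    exact hτ _ (hfU e)

/-- A section of the adjacency that is the identity on repeated elements and avoids a chosen
element of each `soleElems F i`. -/
lemma exists_section
    (h_inter : ∀ (I : Finset (Fin m)) (j : Fin m), j ∉ I → (#(unionF F I ∩ F j) : ℤ) < ρ j)
    (h_lt : ∀ i, ρ i < (#(F i) : ℤ)) {x : Fin m → E} (hx : ∀ i, x i ∈ soleElems F i) :
    ∃ τ : MidVertex F ρ → E, Function.Injective τ ∧ (∀ e, τ (.inl e) = e.1) ∧
      (∀ v, τ (.inr v) ∈ soleElems F v.1) ∧ ∀ u i, τ u ≠ x i := by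
  have h : ∀ i, Nonempty (Fin (extraCount F ρ i) ↪ ((soleElems F i).erase (x i))) := by
    intro i
    -- The elements of label {i} outnumber the l_i extra vertices by |F_i| - ρ(F_i) ≥ 1, which
    -- leaves room to spare `x i`.
    refine Function.Embedding.nonempty_of_card_le ?_
    rw [Fintype.card_fin, Fintype.card_coe, card_erase_of_mem (hx i)]
    have h1 := (cast_extraCount h_inter i).2
    have h2 := card_eq_card_filter_add_card_soleElems (F := F) i
    have h3 := h_lt i
    omega
  obtain ⟨g⟩ := Classical.nonempty_pi.2 h
  have hg : ∀ v : Σ i, Fin (extraCount F ρ i), (g v.1 v.2).1 ∈ soleElems F v.1 :=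
    fun v => (mem_erase.1 (g v.1 v.2).2).2
  have hinl : ∀ (e : {e : E // 2 ≤ #(elemLabel F e)}) i, e.1 ∉ soleElems F i := by
    intro e i he
    have := e.2
    rw [mem_soleElems.1 he, card_singleton] at this
    omega
  refine ⟨Sum.elim Subtype.val fun v => (g v.1 v.2).1, ?_, fun _ => rfl, hg, ?_⟩
  · rintro (e | ⟨i, j⟩) (e' | ⟨i', j'⟩) h
    · exact congrArg _ (Subtype.ext h)
    · refine absurd ?_ (hinl e i')
      exact (show e.1 = (g i' j').1 from h) ▸ hg ⟨i', j'⟩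
    · refine absurd ?_ (hinl e' i)
      exact (show (g i j).1 = e'.1 from h) ▸ hg ⟨i, j⟩
    · replace h : (g i j).1 = (g i' j').1 := h
      have h1 := mem_soleElems.1 (hg ⟨i, j⟩)
      have h2 := mem_soleElems.1 (hg ⟨i', j'⟩)
      simp only [h] at h1
      obtain rfl : i = i' := singleton_injective (h1.symm.trans h2)
      rw [(g i).injective (Subtype.ext h)]
  · rintro (e | v) i h
    · exact hinl e i ((show e.1 = x i from h) ▸ hx i)
    · have h1 := mem_soleElems.1 (hg v)
      replace h : (g v.1 v.2).1 = x i := h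
      rw [h, mem_soleElems.1 (hx i)] at h1
      obtain rfl := singleton_injective h1
      exact (mem_erase.1 (g v.1 v.2).2).1 h

lemma elemLabel_subset_of_section {τ : MidVertex F ρ → E} (h₁ : ∀ e, τ (.inl e) = e.1)
    (h₂ : ∀ v, τ (.inr v) ∈ soleElems F v.1) (u : MidVertex F ρ) :
    elemLabel F (τ u) ⊆ midLabel F ρ u := by
  rcases u with e | v
  · rw [h₁]
    exact Subset.rfl
  · rw [mem_soleElems.1 (h₂ v)]
    exact Subset.rfl

lemma mem_unionF_of_section {τ : MidVertex F ρ → E} (h₁ : ∀ e, τ (.inl e) = e.1)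
    (h₂ : ∀ v, τ (.inr v) ∈ soleElems F v.1) {I : Finset (Fin m)} {u : MidVertex F ρ}
    (hu : u ∈ midMeet F ρ I) : τ u ∈ unionF F I := by
  obtain ⟨i, hi, hu⟩ := mem_midMeet.1 hu
  rcases u with e | v
  · rw [h₁]
    exact mem_unionF.2 ⟨i, hi, mem_elemLabel.1 hu⟩
  · obtain rfl := mem_singleton.1 hu
    exact mem_unionF.2 ⟨_, hi, mem_of_mem_soleElems (h₂ v)⟩

lemma soleElems_nonempty
    (h_inter : ∀ (I : Finset (Fin m)) (j : Fin m), j ∉ I → (#(unionF F I ∩ F j) : ℤ) < ρ j)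
    (h_lt : ∀ i, ρ i < (#(F i) : ℤ)) (i : Fin m) : (soleElems F i).Nonempty := by
  rw [← card_pos]
  have h1 := (cast_extraCount h_inter i).1
  have h2 := card_eq_card_filter_add_card_soleElems (F := F) i
  have h3 := h_lt i
  omega

/-- A section of the adjacency that avoids a given element of `F i`. -/
lemma exists_section_avoiding
    (h_inter : ∀ (I : Finset (Fin m)) (j : Fin m), j ∉ I → (#(unionF F I ∩ F j) : ℤ) < ρ j)
    (h_lt : ∀ i, ρ i < (#(F i) : ℤ)) {e : E} {i : Fin m} (he : e ∈ F i) :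
    ∃ τ : MidVertex F ρ → E, Function.Injective τ ∧
      (∀ u, elemLabel F (τ u) ⊆ midLabel F ρ u) ∧ (∀ u, τ u ≠ e) ∧
      ∀ I, i ∈ I → ∀ u ∈ midMeet F ρ I, τ u ∈ unionF F I := by
  choose x hx using soleElems_nonempty h_inter h_lt
  by_cases h2 : 2 ≤ #(elemLabel F e)
  · obtain ⟨τ, hinj, h₁, h₂, hav⟩ := exists_section h_inter h_lt hx
    -- Only u_e is sent to the repeated element `e`; it is rerouted to the spared element `x i`.
    have hlab : ∀ u ≠ .inl ⟨e, h2⟩, Function.update τ (.inl ⟨e, h2⟩) (x i) u = τ u :=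
      fun u hu => Function.update_of_ne hu _ _
    refine ⟨Function.update τ (.inl ⟨e, h2⟩) (x i), ?_, fun u => ?_, fun u => ?_,
      fun I hI u hu => ?_⟩
    · intro u u' huu
      by_cases hu : u = .inl ⟨e, h2⟩ <;> by_cases hu' : u' = .inl ⟨e, h2⟩
      · rw [hu, hu']
      · rw [hlab u' hu', hu, Function.update_self] at huu
        exact absurd huu.symm (hav _ _)
      · rw [hlab u hu, hu', Function.update_self] at huu
        exact absurd huu (hav _ _)
      · rw [hlab u hu, hlab u' hu'] at huu
        exact hinj huu
    · by_cases hu : u = .inl ⟨e, h2⟩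
      · subst hu
        rw [Function.update_self, mem_soleElems.1 (hx i)]
        exact singleton_subset_iff.2 (mem_elemLabel.2 he)
      · rw [hlab u hu]
        exact elemLabel_subset_of_section h₁ h₂ u
    · by_cases hu : u = .inl ⟨e, h2⟩
      · subst hu
        rw [Function.update_self]
        rintro rfl
        rw [mem_soleElems.1 (hx i), card_singleton] at h2
        omega
      · rw [hlab u hu]
        intro h
        exact hu (hinj (h.trans (h₁ ⟨e, h2⟩).symm))
    · by_cases hu' : u = .inl ⟨e, h2⟩
      · subst hu'
        rw [Function.update_self]
        exact mem_unionF.2 ⟨i, hI, mem_of_mem_soleElems (hx i)⟩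
      · rw [hlab u hu']
        exact mem_unionF_of_section h₁ h₂ hu
  · have hei : e ∈ soleElems F i := by
      refine mem_soleElems.2 (eq_of_subset_of_card_le
        (singleton_subset_iff.2 (mem_elemLabel.2 he)) ?_).symm
      rw [card_singleton]
      omega
    -- An element of label {i} can itself serve as the spared element of F_i.
    have hx' : ∀ j, Function.update x i e j ∈ soleElems F j := by
      intro j
      by_cases hj : j = i
      · subst hj
        rwa [Function.update_self]
      · rw [Function.update_of_ne hj]
        exact hx j
    obtain ⟨τ, hinj, h₁, h₂, hav⟩ := exists_section h_inter h_lt hx'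
    refine ⟨τ, hinj, elemLabel_subset_of_section h₁ h₂, fun u => ?_,
      fun I _ u hu => mem_unionF_of_section h₁ h₂ hu⟩
    simpa using hav u i

end construction

/-! ### The gammoid -/

section gammoid

variable {E : Type u} [Fintype E] [DecidableEq E] {m : ℕ} {F : Fin m → Finset E} {k : ℕ}
  {ρ : Fin m → ℤ}

/-- The graph is layered and no arc leaves `T`, so a path from `E` to `T` has exactly three
vertices. -/
lemma exists_eq_of_isPathFromTo {X : Set E} {p : List (AlgVertex F k ρ)}
    (hp : IsPathFromTo (algGraph F k ρ) (algSource F k ρ '' X) (algSinks F k ρ) p) :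
    ∃ e ∈ X, ∃ u t, elemLabel F e ⊆ midLabel F ρ u ∧ p = [.inl e, .inr (.inl u), .inr (.inr t)] := by
  obtain ⟨hc, ⟨_, ⟨e, he, rfl⟩, hhead⟩, _, ⟨t, rfl⟩, hlast⟩ := hp
  rcases p with _ | ⟨a, _ | ⟨b, _ | ⟨c, _ | ⟨d, p⟩⟩⟩⟩
  · simp at hhead
  · simp only [List.head?_cons, List.getLast?_singleton, Option.some_inj] at hhead hlast
    exact absurd (hhead.symm.trans hlast) (by simp [algSource])
  · simp only [List.head?_cons, Option.some_inj, List.getLast?_cons_cons,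
      List.getLast?_singleton] at hhead hlast
    subst hhead hlast
    exact absurd hc (by simp [algGraph, algSource])
  · simp only [List.head?_cons, Option.some_inj, List.getLast?_cons_cons,
      List.getLast?_singleton] at hhead hlast
    subst hhead hlast
    simp only [List.isChain_cons_cons, List.isChain_singleton, and_true] at hc
    rcases b with b | u | b
    · exact absurd hc.1 (by simp [algGraph, algSource])
    · exact ⟨e, he, u, t, hc.1, rfl⟩
    · exact absurd hc.1 (by simp [algGraph, algSource])
  · simp only [List.head?_cons, Option.some_inj] at hhead
    subst hhead
    simp only [List.isChain_cons_cons] at hc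
    obtain ⟨h1, h2, h3, -⟩ := hc
    rcases b with b | u | b <;> rcases c with c | u' | c <;> simp [algGraph, algSource] at h1 h2 h3

lemma isPathFromTo_algGraph {X : Set E} {e : E} (he : e ∈ X) {u : MidVertex F ρ} (t : Fin k)
    (hu : elemLabel F e ⊆ midLabel F ρ u) :
    IsPathFromTo (algGraph F k ρ) (algSource F k ρ '' X) (algSinks F k ρ)
      [.inl e, .inr (.inl u), .inr (.inr t)] := by
  refine ⟨?_, ⟨_, ⟨e, he, rfl⟩, rfl⟩, _, ⟨t, rfl⟩, rfl⟩
  simp only [List.isChain_cons_cons, List.isChain_singleton, and_true]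
  exact ⟨hu, trivial⟩

/-- Linkings of a set of sources into the sinks are matchings of at most `k` elements into the
middle layer. -/
lemma image_mem_gammoidIndepSets_iff (X : Finset E) :
    algSource F k ρ '' (X : Set E) ∈
        gammoidIndepSets (algGraph F k ρ) (Set.range (algSource F k ρ)) (algSinks F k ρ) ↔
      #X ≤ k ∧ ∃ f : X → MidVertex F ρ, Function.Injective f ∧
        ∀ e : X, f e ∈ midNeighbors F ρ e := by
  have hinj : Function.Injective (algSource F k ρ) := Sum.inl_injective
  constructor
  · rintro ⟨-, P, hPc, hP, hdisj⟩
    rw [hinj.encard_image, Set.encard_coe_eq_coe_finsetCard] at hPc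
    have hPfin : P.Finite := Set.finite_of_encard_eq_coe hPc
    have h : ∀ p : P, ∃ e ∈ X, ∃ u t, elemLabel F e ⊆ midLabel F ρ u ∧
        p.1 = [.inl e, .inr (.inl u), .inr (.inr t)] := by
      intro p
      simpa using exists_eq_of_isPathFromTo (hP p.1 p.2)
    choose s hsX u t hu hp using h
    have hne : ∀ p q : P, p ≠ q → List.Disjoint p.1 q.1 :=
      fun p q hpq => hdisj p.2 q.2 (fun h => hpq (Subtype.ext h))
    have hs : Function.Injective s := by
      intro p q hpq
      by_contra hc
      have := hne p q hc
      rw [hp p, hp q, hpq] at this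
      exact this (List.mem_cons_self) (List.mem_cons_self)
    have hu' : Function.Injective u := by
      intro p q hpq
      by_contra hc
      have := hne p q hc
      rw [hp p, hp q, hpq] at this
      exact this (a := .inr (.inl (u q))) (by simp) (by simp)
    have ht : Function.Injective t := by
      intro p q hpq
      by_contra hc
      have := hne p q hc
      rw [hp p, hp q, hpq] at this
      exact this (a := .inr (.inr (t q))) (by simp) (by simp)
    have := hPfin.fintype
    have hcard : Fintype.card P = #X := by
      rw [← Set.toFinset_card, ← Nat.cast_inj (R := ℕ∞), ← hPc, ← Set.encard_coe_eq_coe_finsetCard,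
        Set.coe_toFinset]
    let s' : P → X := fun p => ⟨s p, hsX p⟩
    -- There are |X| disjoint paths starting in `X`, so every element of `X` is the source of
    -- exactly one; its middle vertex is the match.
    have hs' : Function.Bijective s' :=
      (Fintype.bijective_iff_injective_and_card s').2
        ⟨fun p q hpq => hs (congrArg (fun e : X => e.1) hpq), by simp [hcard]⟩
    refine ⟨?_, u ∘ (Equiv.ofBijective s' hs').symm, hu'.comp (Equiv.injective _), fun e => ?_⟩
    · rw [← hcard]
      simpa using Fintype.card_le_of_injective t ht
    · have he : s' ((Equiv.ofBijective s' hs').symm e) = e :=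
        (Equiv.ofBijective s' hs').apply_symm_apply e
      refine mem_midNeighbors.2 ?_
      conv_lhs => rw [← he]
      exact hu _
  · rintro ⟨hk, f, hf, hft⟩
    obtain ⟨g⟩ : Nonempty (X ↪ Fin k) := Function.Embedding.nonempty_of_card_le (by simpa using hk)
    refine ⟨Set.image_subset_range _ _, Set.range fun e : X =>
      ([.inl e.1, .inr (.inl (f e)), .inr (.inr (g e))] : List (AlgVertex F k ρ)), ?_, ?_, ?_⟩
    · have hr : Function.Injective fun e : X =>
          ([.inl e.1, .inr (.inl (f e)), .inr (.inr (g e))] : List (AlgVertex F k ρ)) := by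
        intro e e' h
        simpa using (List.cons.inj h).1
      rw [← Set.image_univ, hr.encard_image, hinj.encard_image, Set.encard_univ,
        Set.encard_coe_eq_coe_finsetCard, ENat.card_eq_coe_fintype_card, Fintype.card_coe]
    · rintro _ ⟨e, rfl⟩
      exact isPathFromTo_algGraph e.2 (g e) (mem_midNeighbors.1 (hft e))
    · rintro _ ⟨e, rfl⟩ _ ⟨e', rfl⟩ hne
      have hee : e ≠ e' := fun h => hne (by rw [h])
      have h1 : e.1 ≠ e'.1 := fun h => hee (Subtype.ext h)
      have h2 : f e ≠ f e' := fun h => hee (hf h)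
      have h3 : g e ≠ g e' := fun h => hee (g.injective h)
      intro a ha ha'
      simp only [List.mem_cons, List.not_mem_nil, or_false] at ha ha'
      rcases ha with rfl | rfl | rfl <;> simp_all

end gammoid

/-! ### Cyclic flats, uniqueness and parameters of the constructed matroid -/

section flats

variable {E : Type u} [Fintype E] [DecidableEq E] {m : ℕ} {F : Fin m → Finset E} {k : ℕ}
  {ρ : Fin m → ℤ} {M : Matroid E}

lemma matroidRank_unionF_le
    (h_inter : ∀ (I : Finset (Fin m)) (j : Fin m), j ∉ I → (#(unionF F I ∩ F j) : ℤ) < ρ j)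
    (hM : ∀ X : Finset E, M.Indep (X : Set E) ↔ X ∈ constructionIndepSets F k ρ)
    (I : Finset (Fin m)) :
    matroidRank M (unionF F I : Set E) ≤ min #(midMeet F ρ I) k := by
  refine matroidRank_le_of_forall_indep M fun J hJI hJ => ?_
  lift J to Finset E using J.toFinite
  have h := (hM J).1 hJ I
  rw [inter_eq_right.2 (by exact_mod_cast hJI), nominalRank_eq_card_midMeet h_inter] at h
  rw [Set.ncard_coe_finset]
  exact_mod_cast h

/-- Any min(|U|, k) vertices of `U` have an independent image, matched back into `H` by inverting
`τ`. -/
lemma card_le_matroidRank_of_section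
    (h_union : unionF F Finset.univ = Finset.univ)
    (h_inter : ∀ (I : Finset (Fin m)) (j : Fin m), j ∉ I → (#(unionF F I ∩ F j) : ℤ) < ρ j)
    (hM : ∀ X : Finset E, M.Indep (X : Set E) ↔ X ∈ constructionIndepSets F k ρ)
    {τ : MidVertex F ρ → E} {U : Finset (MidVertex F ρ)} (hinj : Set.InjOn τ U)
    (hτ : ∀ u ∈ U, elemLabel F (τ u) ⊆ midLabel F ρ u) {Y : Set E} (hY : ∀ u ∈ U, τ u ∈ Y) :
    min #U k ≤ matroidRank M Y := by
  obtain ⟨V, hVU, hV⟩ := exists_subset_card_eq (min_le_left #U k)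
  have h1 : M.Indep (V.image τ : Finset E) := (hM _).2 <|
    image_mem_constructionIndepSets h_union h_inter (fun u hu => hτ u (hVU hu))
      (hV.trans_le (min_le_right _ _))
  have h2 := h1.ncard_le_matroidRank (X := Y) (by
    intro e he
    obtain ⟨u, hu, rfl⟩ := mem_image.1 (mem_coe.1 he)
    exact hY u (hVU hu))
  rwa [Set.ncard_coe_finset, card_image_of_injOn (hinj.mono (by exact_mod_cast hVU)), hV] at h2

lemma le_matroidRank_unionF_sdiff_singleton
    (h_union : unionF F Finset.univ = Finset.univ)
    (h_inter : ∀ (I : Finset (Fin m)) (j : Fin m), j ∉ I → (#(unionF F I ∩ F j) : ℤ) < ρ j)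
    (h_lt : ∀ i, ρ i < (#(F i) : ℤ))
    (hM : ∀ X : Finset E, M.Indep (X : Set E) ↔ X ∈ constructionIndepSets F k ρ)
    {I : Finset (Fin m)} {i : Fin m} (hi : i ∈ I) {e : E} (he : e ∈ F i) :
    min #(midMeet F ρ I) k ≤ matroidRank M ((unionF F I : Set E) \ {e}) := by
  obtain ⟨τ, hinj, hlab, hne, hmem⟩ := exists_section_avoiding h_inter h_lt he
  exact card_le_matroidRank_of_section h_union h_inter hM hinj.injOn (fun u _ => hlab u)
    fun u hu => ⟨hmem I hi u hu, hne u⟩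

lemma matroidRank_unionF
    (h_union : unionF F Finset.univ = Finset.univ)
    (h_inter : ∀ (I : Finset (Fin m)) (j : Fin m), j ∉ I → (#(unionF F I ∩ F j) : ℤ) < ρ j)
    (h_lt : ∀ i, ρ i < (#(F i) : ℤ))
    (hM : ∀ X : Finset E, M.Indep (X : Set E) ↔ X ∈ constructionIndepSets F k ρ)
    (I : Finset (Fin m)) :
    matroidRank M (unionF F I : Set E) = min #(midMeet F ρ I) k := by
  refine (matroidRank_unionF_le h_inter hM I).antisymm ?_
  rcases I.eq_empty_or_nonempty with rfl | ⟨i, hi⟩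
  · simp [midMeet]
  · obtain ⟨e, he⟩ := soleElems_nonempty h_inter h_lt i
    exact (le_matroidRank_unionF_sdiff_singleton h_union h_inter h_lt hM hi
      (mem_of_mem_soleElems he)).trans (matroidRank_mono M Set.sdiff_subset)

lemma matroidRank_univ
    (h_union : unionF F Finset.univ = Finset.univ)
    (h_k : (k : ℤ) ≤ nominalRank F ρ Finset.univ)
    (h_inter : ∀ (I : Finset (Fin m)) (j : Fin m), j ∉ I → (#(unionF F I ∩ F j) : ℤ) < ρ j)
    (h_lt : ∀ i, ρ i < (#(F i) : ℤ))
    (hM : ∀ X : Finset E, M.Indep (X : Set E) ↔ X ∈ constructionIndepSets F k ρ) :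
    matroidRank M Set.univ = k := by
  have h := matroidRank_unionF h_union h_inter h_lt hM univ
  rw [nominalRank_eq_card_midMeet h_inter, Nat.cast_le] at h_k
  rwa [h_union, coe_univ, min_eq_right h_k] at h

/-- An `e` outside F_I has the label of some vertex `u₀` not counted by ν(I). Sending `u₀` to `e`
gives ν(I) + 1 ≤ k independent elements, so adjoining `e` raises the rank. -/
lemma isFlat_unionF
    (h_union : unionF F Finset.univ = Finset.univ)
    (h_inter : ∀ (I : Finset (Fin m)) (j : Fin m), j ∉ I → (#(unionF F I ∩ F j) : ℤ) < ρ j)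
    (h_lt : ∀ i, ρ i < (#(F i) : ℤ)) (hME : M.E = Set.univ)
    (hM : ∀ X : Finset E, M.Indep (X : Set E) ↔ X ∈ constructionIndepSets F k ρ)
    {I : Finset (Fin m)} (hI : #(midMeet F ρ I) < k) : M.IsFlat (unionF F I : Set E) := by
  rw [Matroid.isFlat_iff_closure_eq]
  refine (M.subset_closure _ (by simp [hME])).antisymm' fun e he => ?_
  by_contra heI
  have hle : matroidRank M (insert e (unionF F I : Set E)) ≤ #(midMeet F ρ I) := by
    have h1 := matroidRank_mono M
      (Set.insert_subset he (M.subset_closure (unionF F I : Set E) (by simp [hME])))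
    rw [matroidRank_closure] at h1
    exact h1.trans ((matroidRank_unionF_le h_inter hM I).trans (min_le_left _ _))
  choose x hx using soleElems_nonempty h_inter h_lt
  obtain ⟨τ, hinj, h₁, h₂, -⟩ := exists_section h_inter h_lt hx
  obtain ⟨u₀, hu₀⟩ : ∃ u₀ : MidVertex F ρ, elemLabel F e = midLabel F ρ u₀ := by
    by_cases h2 : 2 ≤ #(elemLabel F e)
    · exact ⟨.inl ⟨e, h2⟩, rfl⟩
    · obtain ⟨i, -, hi⟩ : ∃ i ∈ univ, e ∈ F i := by rw [← mem_unionF, h_union]; exact mem_univ _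
      have h0 := cast_extraCount h_inter i
      -- The index 0 is available because l_i ≥ 1.
      refine ⟨.inr ⟨i, ⟨0, by omega⟩⟩, (eq_of_subset_of_card_le
        (singleton_subset_iff.2 (mem_elemLabel.2 hi)) ?_).symm⟩
      rw [card_singleton]
      omega
  have hu₀I : u₀ ∉ midMeet F ρ I := by
    intro h
    obtain ⟨i, hi, hiu⟩ := mem_midMeet.1 h
    rw [← hu₀] at hiu
    exact heI (mem_coe.2 (mem_unionF.2 ⟨i, hi, mem_elemLabel.1 hiu⟩))
  have hup : ∀ u ∈ midMeet F ρ I, Function.update τ u₀ e u = τ u :=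
    fun u hu => Function.update_of_ne (ne_of_mem_of_not_mem hu hu₀I) _ _
  have hge := card_le_matroidRank_of_section h_union h_inter hM (τ := Function.update τ u₀ e)
    (U := insert u₀ (midMeet F ρ I)) (Y := insert e (unionF F I : Set E)) ?_ ?_ ?_
  · rw [card_insert_of_notMem hu₀I] at hge
    omega
  · rw [coe_insert, Set.injOn_insert (by simpa using hu₀I)]
    refine ⟨fun u hu v hv huv => ?_, ?_⟩
    · rw [hup u hu, hup v hv] at huv
      exact hinj huv
    · rintro ⟨u, hu, huv⟩
      rw [hup u hu, Function.update_self] at huv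
      exact heI (huv ▸ mem_coe.2 (mem_unionF_of_section h₁ h₂ hu))
  · intro u hu
    rcases mem_insert.1 hu with rfl | hu
    · rw [Function.update_self, hu₀]
    · rw [hup u hu]
      exact elemLabel_subset_of_section h₁ h₂ u
  · intro u hu
    rcases mem_insert.1 hu with rfl | hu
    · rw [Function.update_self]
      exact Set.mem_insert _ _
    · rw [hup u hu]
      exact Set.mem_insert_of_mem _ (mem_unionF_of_section h₁ h₂ hu)

lemma exists_sUnion_circuits_eq_unionF
    (h_union : unionF F Finset.univ = Finset.univ)
    (h_inter : ∀ (I : Finset (Fin m)) (j : Fin m), j ∉ I → (#(unionF F I ∩ F j) : ℤ) < ρ j)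
    (h_lt : ∀ i, ρ i < (#(F i) : ℤ)) (hME : M.E = Set.univ)
    (hM : ∀ X : Finset E, M.Indep (X : Set E) ↔ X ∈ constructionIndepSets F k ρ)
    (I : Finset (Fin m)) :
    ∃ 𝒞 : Set (Set E), (∀ C ∈ 𝒞, M.IsCircuit C) ∧ (unionF F I : Set E) = ⋃₀ 𝒞 := by
  refine ⟨{C | M.IsCircuit C ∧ C ⊆ unionF F I}, fun C hC => hC.1,
    Set.Subset.antisymm (fun e he => ?_) (Set.sUnion_subset fun C hC => hC.2)⟩
  obtain ⟨i, hi, hei⟩ := mem_unionF.1 (mem_coe.1 he)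
  have h1 := subset_closure_of_matroidRank_le (M := M) (Y := (unionF F I : Set E)) (by simp [hME])
    Set.sdiff_subset ((matroidRank_unionF_le h_inter hM I).trans
      (le_matroidRank_unionF_sdiff_singleton h_union h_inter h_lt hM hi hei))
  obtain ⟨C, hCs, hC, heC⟩ := Matroid.exists_isCircuit_of_mem_closure (h1 he) (by simp)
  exact ⟨C, ⟨hC, hCs.trans (Set.insert_subset he Set.sdiff_subset)⟩, heC⟩

/-- `C` violates the inequality of some `I`. Already `F_I ∩ C` violates it, so minimality of the
circuit gives `C ⊆ F_I`. As |C| ≤ k, the violated bound is ν(I), so F_I has rank at most ν(I) ≤ |C|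
- 1, the rank of `C`. -/
lemma exists_unionF_of_isCircuit
    (h_inter : ∀ (I : Finset (Fin m)) (j : Fin m), j ∉ I → (#(unionF F I ∩ F j) : ℤ) < ρ j)
    (hME : M.E = Set.univ)
    (hM : ∀ X : Finset E, M.Indep (X : Set E) ↔ X ∈ constructionIndepSets F k ρ)
    {C : Set E} (hC : M.IsCircuit C) (hCk : matroidRank M C < k) :
    ∃ I, C ⊆ unionF F I ∧ (unionF F I : Set E) ⊆ M.closure C := by
  have hrC := hC.matroidRank_add_one
  lift C to Finset E using C.toFinite
  rw [Set.ncard_coe_finset] at hrC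
  have hdep := (hM C).not.1 hC.not_indep
  simp only [constructionIndepSets, Set.mem_ofPred_eq, not_forall, not_le,
    nominalRank_eq_card_midMeet h_inter] at hdep
  obtain ⟨I, hI⟩ := hdep
  have hCI : C ⊆ unionF F I := by
    have h1 : ¬ M.Indep ((unionF F I ∩ C : Finset E) : Set E) := by
      rw [hM]
      intro h
      have := h I
      rw [← inter_assoc, inter_self, nominalRank_eq_card_midMeet h_inter] at this
      omega
    have h2 := hC.eq_of_not_indep_subset h1 (by simp)
    exact inter_eq_right.1 (by exact_mod_cast h2)
  rw [inter_eq_right.2 hCI] at hI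
  refine ⟨I, by exact_mod_cast hCI, subset_closure_of_matroidRank_le (by simp [hME])
    (by exact_mod_cast hCI) ?_⟩
  have h3 := matroidRank_unionF_le h_inter hM I
  omega

/-- The cyclic flats of the matroid with the prescribed independent sets. -/
lemma isCyclicFlat_iff_mem_cyclicFlatFamily
    (h_union : unionF F Finset.univ = Finset.univ)
    (h_k : (k : ℤ) ≤ nominalRank F ρ Finset.univ)
    (h_inter : ∀ (I : Finset (Fin m)) (j : Fin m), j ∉ I → (#(unionF F I ∩ F j) : ℤ) < ρ j)
    (h_lt : ∀ i, ρ i < (#(F i) : ℤ)) (hME : M.E = Set.univ)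
    (hM : ∀ X : Finset E, M.Indep (X : Set E) ↔ X ∈ constructionIndepSets F k ρ) (Z : Set E) :
    IsCyclicFlat M Z ↔ Z ∈ cyclicFlatFamily F k ρ := by
  simp only [cyclicFlatFamily, Set.mem_union, Set.mem_ofPred_eq, Set.mem_singleton_iff,
    nominalRank_eq_card_midMeet h_inter, Nat.cast_lt]
  constructor
  · classical
    rintro ⟨hZ, 𝒞, h𝒞, hZ𝒞⟩
    refine or_iff_not_imp_right.2 fun hne => ?_
    have hrk : matroidRank M Z < k := by
      by_contra! hle
      refine hne (Set.eq_univ_of_univ_subset ?_)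
      have h1 := subset_closure_of_matroidRank_le (M := M) (Y := Set.univ) (X := Z) (by simp [hME])
        (Set.subset_univ _) (by rwa [matroidRank_univ h_union h_k h_inter h_lt hM])
      rwa [hZ.closure] at h1
    have h𝒞Z : ∀ C ∈ 𝒞, C ⊆ Z := fun C hC => hZ𝒞 ▸ Set.subset_sUnion_of_mem hC
    have h : ∀ C ∈ 𝒞, ∃ I, C ⊆ unionF F I ∧ (unionF F I : Set E) ⊆ Z := by
      intro C hC
      obtain ⟨I, h1, h2⟩ := exists_unionF_of_isCircuit h_inter hME hM (h𝒞 C hC)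
        ((matroidRank_mono M (h𝒞Z C hC)).trans_lt hrk)
      refine ⟨I, h1, h2.trans ?_⟩
      have := M.closure_subset_closure (h𝒞Z C hC)
      rwa [hZ.closure] at this
    -- Each circuit in `Z` is covered by sets F_i contained in `Z`, so all such F_i together exhaust
    -- `Z`.
    have hZJ : Z = (unionF F (univ.filter fun i => (F i : Set E) ⊆ Z) : Set E) := by
      refine Set.Subset.antisymm (fun e he => ?_) (fun e he => ?_)
      · rw [hZ𝒞] at he
        obtain ⟨C, hC, heC⟩ := he
        obtain ⟨I, h1, h2⟩ := h C hC
        obtain ⟨i, hi, hei⟩ := mem_unionF.1 (mem_coe.1 (h1 heC))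
        refine mem_coe.2 (mem_unionF.2 ⟨i, mem_filter.2 ⟨mem_univ _, fun x hx => h2 ?_⟩, hei⟩)
        exact mem_coe.2 (mem_unionF.2 ⟨i, hi, hx⟩)
      · obtain ⟨i, hi, hei⟩ := mem_unionF.1 (mem_coe.1 he)
        exact (mem_filter.1 hi).2 hei
    refine ⟨_, ?_, hZJ⟩
    rw [hZJ, matroidRank_unionF h_union h_inter h_lt hM] at hrk
    omega
  · rintro (⟨J, hJ, rfl⟩ | rfl)
    · exact ⟨isFlat_unionF h_union h_inter h_lt hME hM hJ,
        exists_sUnion_circuits_eq_unionF h_union h_inter h_lt hME hM J⟩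
    · refine ⟨hME ▸ M.ground_isFlat, ?_⟩
      have := exists_sUnion_circuits_eq_unionF h_union h_inter h_lt hME hM univ
      rwa [h_union, coe_univ] at this

theorem isConstructedMatroid_of_indep_iff
    (h_union : unionF F Finset.univ = Finset.univ)
    (h_k : (k : ℤ) ≤ nominalRank F ρ Finset.univ)
    (h_inter : ∀ (I : Finset (Fin m)) (j : Fin m), j ∉ I → (#(unionF F I ∩ F j) : ℤ) < ρ j)
    (h_lt : ∀ i, ρ i < (#(F i) : ℤ)) (hME : M.E = Set.univ)
    (hM : ∀ X : Finset E, M.Indep (X : Set E) ↔ X ∈ constructionIndepSets F k ρ) :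
    IsConstructedMatroid F k ρ M := by
  refine ⟨hME, isCyclicFlat_iff_mem_cyclicFlatFamily h_union h_k h_inter h_lt hME hM,
    fun J hJ => ?_, matroidRank_univ h_union h_k h_inter h_lt hM⟩
  rw [nominalRank_eq_card_midMeet h_inter, Nat.cast_lt] at hJ
  rw [nominalRank_eq_card_midMeet h_inter, matroidRank_unionF h_union h_inter h_lt hM,
    min_eq_left hJ.le]

/-- The matroid with the prescribed cyclic flats and ranks is unique. -/
theorem IsConstructedMatroid.eq {M' : Matroid E} (hM : IsConstructedMatroid F k ρ M)
    (hM' : IsConstructedMatroid F k ρ M') : M' = M := by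
  refine Matroid.ext_indep (hM'.1.trans hM.1.symm) fun X hX => ?_
  rw [indep_iff_forall_isCyclicFlat hX, indep_iff_forall_isCyclicFlat (by simp [hM.1])]
  refine forall_congr' fun Z => ?_
  rw [hM.2.1, hM'.2.1]
  refine imp_congr_right fun hZ => ?_
  suffices matroidRank M' Z = matroidRank M Z by rw [this]
  rcases hZ with ⟨J, hJ, rfl⟩ | rfl
  · have h1 := hM.2.2.1 J hJ
    have h2 := hM'.2.2.1 J hJ
    omega
  · rw [hM.2.2.2, hM'.2.2.2]

/-- A set of rank less than `k` has nullity at most the largest nullity of a cyclic flat of rank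
less than `k`. -/
lemma IsConstructedMatroid.ncard_le (hM : IsConstructedMatroid F k ρ M) {Y : Set E}
    (hY : matroidRank M Y < k) : ∃ I, nominalRank F ρ I < k ∧
      (Y.ncard : ℤ) ≤ matroidRank M Y + ∑ i ∈ I, ((#(F i) : ℤ) - ρ i) := by
  have hfl := M.isFlat_closure Y
  have hcyc := isCyclicFlat_sUnion_circuits hfl
  have hnull := ncard_add_matroidRank_sUnion_circuits_le hfl
  have hZ : (⋃₀ {C | M.IsCircuit C ∧ C ⊆ M.closure Y}) ⊆ M.closure Y :=
    Set.sUnion_subset fun C hC => hC.2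
  have hr := matroidRank_mono M hZ
  set Z := ⋃₀ {C | M.IsCircuit C ∧ C ⊆ M.closure Y}
  have hYc := Set.ncard_le_ncard (M.subset_closure Y (by simp [hM.1])) (Set.toFinite _)
  rw [matroidRank_closure] at hnull hr
  rw [hM.2.1] at hcyc
  -- The cyclic part of the closure of `Y` carries all its nullity. It is some F_I, of nullity ∑
  -- η(F_i); it is not `E`, whose rank is `k`.
  rcases hcyc with ⟨I, hI, hZI⟩ | hZI
  · refine ⟨I, hI, ?_⟩
    have h1 := hM.2.2.1 I hI
    rw [hZI, Set.ncard_coe_finset] at hnull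
    have h2 : nominalRank F ρ I = #(unionF F I) - ∑ i ∈ I, ((#(F i) : ℤ) - ρ i) := by
      rw [nominalRank, sub_eq_add_neg, ← sum_neg_distrib]
      simp
    omega
  · rw [hZI, hM.2.2.2] at hr
    omega

/-- The minimum distance of the constructed matroid. -/
lemma IsConstructedMatroid.exists_min_dist (hM : IsConstructedMatroid F k ρ M) (hk : 1 ≤ k) :
    ∃ d : ℕ, (∃ μ : ℤ, IsGreatest {t : ℤ | ∃ I : Finset (Fin m), nominalRank F ρ I < k ∧
        t = ∑ i ∈ I, ((#(F i) : ℤ) - ρ i)} μ ∧ (d : ℤ) = (Fintype.card E : ℤ) - k + 1 - μ) ∧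
      IsLeast {t : ℕ | ∃ X : Set E, X ⊆ M.E ∧ matroidRank M (M.E \ X) < k ∧ t = X.ncard} d := by
  obtain ⟨I, hI, hmax⟩ := exists_max_image (univ.filter fun I => nominalRank F ρ I < k)
    (fun I => ∑ i ∈ I, ((#(F i) : ℤ) - ρ i))
    ⟨∅, by simpa [nominalRank, unionF] using Nat.lt_of_succ_le hk⟩
  replace hI : nominalRank F ρ I < k := (mem_filter.1 hI).2
  have hrI := hM.2.2.1 I hI
  have hnI : nominalRank F ρ I = #(unionF F I) - ∑ i ∈ I, ((#(F i) : ℤ) - ρ i) := by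
    rw [nominalRank, sub_eq_add_neg, ← sum_neg_distrib]
    simp
  have hcompl : #(unionF F I)ᶜ + #(unionF F I) = Fintype.card E := card_compl_add_card _
  have hkle : k ≤ matroidRank M (unionF F I : Set E) + #(unionF F I)ᶜ := by
    have := matroidRank_union_le M (unionF F I : Set E) ((unionF F I)ᶜ : Finset E)
    rwa [← coe_union, union_compl, coe_univ, hM.2.2.2, Set.ncard_coe_finset] at this
  -- Removing `X` leaves F_I, of largest nullity, and k - 1 - ν(I) further elements, so the rank
  -- stays below `k`.
  obtain ⟨X, hX, hXc⟩ := exists_subset_card_eq (s := (unionF F I)ᶜ)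
    (n := #(unionF F I)ᶜ + matroidRank M (unionF F I : Set E) + 1 - k) (by omega)
  refine ⟨#X, ⟨_, ⟨⟨I, hI, rfl⟩, ?_⟩, by omega⟩, ⟨X, by simp [hM.1], ?_, by simp⟩, ?_⟩
  · rintro _ ⟨J, hJ, rfl⟩
    exact hmax J (mem_filter.2 ⟨mem_univ _, hJ⟩)
  · have h1 : M.E \ X = (unionF F I : Set E) ∪ (((unionF F I)ᶜ \ X : Finset E) : Set E) := by
      rw [hM.1]
      ext e
      have := @hX e
      simp only [mem_compl] at this
      simp only [Set.mem_sdiff, Set.mem_univ, true_and, mem_coe, coe_sdiff, coe_compl,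
        Set.mem_union, Set.mem_compl_iff]
      tauto
    rw [h1]
    have h2 := matroidRank_union_le M (unionF F I : Set E) ((unionF F I)ᶜ \ X : Finset E)
    rw [Set.ncard_coe_finset, card_sdiff_of_subset hX] at h2
    omega
  · rintro _ ⟨Y, -, hY, rfl⟩
    obtain ⟨J, hJ, hle⟩ := hM.ncard_le hY
    have h1 := hmax J (mem_filter.2 ⟨mem_univ _, hJ⟩)
    have h2 := Set.ncard_sdiff_add_ncard_of_subset (Set.subset_univ Y) (Set.toFinite _)
    rw [Set.ncard_univ, Nat.card_eq_fintype_card] at h2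
    rw [hM.1] at hle hY
    omega

/-- The parameters of the constructed matroid. -/
theorem IsConstructedMatroid.exists_parameters
    (h_union : unionF F Finset.univ = Finset.univ)
    (h_k : (k : ℤ) ≤ nominalRank F ρ Finset.univ)
    (h_inter : ∀ (I : Finset (Fin m)) (j : Fin m), j ∉ I → (#(unionF F I ∩ F j) : ℤ) < ρ j)
    (h_lt : ∀ i, ρ i < (#(F i) : ℤ))
    (hM : IsConstructedMatroid F k ρ M)
    (hMi : ∀ X : Finset E, M.Indep (X : Set E) ↔ X ∈ constructionIndepSets F k ρ)
    (hk : 1 ≤ k) (hρk : ∀ i, ρ i ≤ k) :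
    ∃ n d r δ : ℕ, AreConstructionParameters F k ρ n d r δ ∧ IsLRMatroid M n k d r δ := by
  -- For m = 0 the bound k ≤ ν([m]) = 0 would contradict k ≥ 1.
  have hne : (univ : Finset (Fin m)).Nonempty := by
    rw [nonempty_iff_ne_empty]
    intro h
    rw [h, nominalRank] at h_k
    simp [unionF] at h_k
    omega
  have hpos : ∀ i, 0 < ρ i := by simpa [unionF] using fun i => h_inter ∅ i (notMem_empty i)
  obtain ⟨a, -, ha⟩ := exists_max_image univ ρ hne
  obtain ⟨b, -, hb⟩ := exists_min_image univ (fun i => (#(F i) : ℤ) - ρ i) hne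
  obtain ⟨d, hd, hdist⟩ := hM.exists_min_dist hk
  have hr : ((ρ a).toNat : ℤ) = ρ a := Int.toNat_of_nonneg (hpos a).le
  have hδ : ((1 + ((#(F b) : ℤ) - ρ b)).toNat : ℤ) = 1 + ((#(F b) : ℤ) - ρ b) :=
    Int.toNat_of_nonneg (by have := h_lt b; omega)
  have hapos := hpos a
  have hak := hρk a
  have hblt := h_lt b
  refine ⟨Fintype.card E, d, (ρ a).toNat, (1 + ((#(F b) : ℤ) - ρ b)).toNat, ⟨rfl, hd, ?_, ?_⟩, ?_,
    ?_, hdist, by omega, by omega, by omega, fun e _ => ?_⟩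
  · rw [hr]
    refine ⟨⟨a, rfl⟩, ?_⟩
    rintro _ ⟨i, rfl⟩
    exact ha i (mem_univ i)
  · refine ⟨_, ⟨⟨b, rfl⟩, ?_⟩, hδ⟩
    rintro _ ⟨i, rfl⟩
    exact hb i (mem_univ i)
  · rw [hM.1, Set.ncard_univ, Nat.card_eq_fintype_card]
  · rw [hM.1, hM.2.2.2]
  · obtain ⟨i, -, hi⟩ : ∃ i ∈ univ, e ∈ F i := by rw [← mem_unionF, h_union]; exact mem_univ _
    have hai := ha i (mem_univ i)
    have hbi := hb i (mem_univ i)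
    have hi0 := hpos i
    -- The size ρ(F_i) + min η = ρ(F_i) + δ - 1 is at most both |F_i| and r + δ - 1. Deleting fewer
    -- than δ elements leaves at least ρ(F_i), and any ρ(F_i) elements of F_i are independent.
    obtain ⟨S, heS, hSF, hSc⟩ := exists_subsuperset_card_eq (singleton_subset_iff.2 hi)
      (n := (ρ i + ((#(F b) : ℤ) - ρ b)).toNat) (by rw [card_singleton]; omega) (by omega)
    refine ⟨S, mem_coe.2 (singleton_subset_iff.1 heS), by simp [hM.1], ?_, fun X hXS hlt => ?_⟩
    · rw [Set.ncard_coe_finset]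
      omega
    · lift X to Finset E using X.toFinite
      rw [Set.ncard_coe_finset]
      by_contra! hX
      rw [coe_subset] at hXS
      have hcard := card_sdiff_add_card_eq_card hXS
      obtain ⟨Y, hYS, hYc⟩ := exists_subset_card_eq (s := S \ X) (n := (ρ i).toNat) (by omega)
      have hY : M.Indep (Y : Set E) := (hMi Y).2 <| mem_constructionIndepSets_of_subset h_inter
        (hρk i) (hYS.trans (sdiff_subset.trans hSF)) (by omega)
      have h1 := hY.ncard_le_matroidRank (X := (S : Set E) \ X) (by exact_mod_cast hYS)
      have h2 := matroidRank_mono M (X := (S : Set E)) (Y := (unionF F {i} : Set E))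
        (by simpa [unionF] using hSF)
      have h3 := matroidRank_unionF_le h_inter hMi {i}
      have h4 := nominalRank_eq_card_midMeet h_inter {i}
      have h5 : nominalRank F ρ {i} = ρ i := by simp [nominalRank, unionF]
      rw [Set.ncard_coe_finset] at h1
      omega

end flats
theorem mainTheorem7 {E : Type u} [Fintype E] [DecidableEq E] {m : ℕ}
    (F : Fin m → Finset E) (k : ℕ) (ρ : Fin m → ℤ)
    (h_rank : ∀ i, 0 ≤ ρ i ∧ ρ i ≤ (#(F i) : ℤ))
    (h_union : unionF F Finset.univ = Finset.univ)
    (h_k : (k : ℤ) ≤ nominalRank F ρ Finset.univ)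
    (h_inter : ∀ (I : Finset (Fin m)) (j : Fin m), j ∉ I → (#(unionF F I ∩ F j) : ℤ) < ρ j) :
    ∃ M : Matroid E,
      -- `M` is the matroid with the prescribed independent sets
      M.E = Set.univ ∧
      (∀ X : Finset E, M.Indep (X : Set E) ↔ X ∈ constructionIndepSets F k ρ) ∧
      -- if `ρ(F_i) < |F_i|` for all `i`, then `M` is the only matroid with the prescribed cyclic
      -- flats and ranks, with the stated parameters whenever these are admissible
      ((∀ i, ρ i < (#(F i) : ℤ)) →
        IsConstructedMatroid F k ρ M ∧
        (∀ M' : Matroid E, IsConstructedMatroid F k ρ M' → M' = M) ∧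
        (1 ≤ k → (∀ i, ρ i ≤ k) → ∃ n d r δ : ℕ,
          AreConstructionParameters F k ρ n d r δ ∧ IsLRMatroid M n k d r δ)) ∧
      -- `M` is the gammoid of the constructed graph
      IsGammoidOf M (algGraph F k ρ) (Set.range (algSource F k ρ)) (algSinks F k ρ)
        (algSource F k ρ) ∧
      -- `M` is represented by linear codes over all large finite fields, which are locally
      -- repairable codes with the parameters of `M`
      ∃ q₀ : ℕ, ∀ (K : Type w) [Field K] [Finite K], q₀ ≤ Nat.card K →
        ∃ C : Submodule K (E → K), CodeRepresents (C : Set (E → K)) M ∧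
          ∀ n k' d r δ : ℕ, IsLRMatroid M n k' d r δ → IsLRC (C : Set (E → K)) n k' d r δ := by

  classical
  have hiff := mem_constructionIndepSets_iff (k := k) h_union h_inter
  -- Generic vectors over the infinite field ℚ supply the matroid axioms.
  obtain ⟨D₀, hD₀⟩ := exists_vectors_transversal.{u, u, 0} (midNeighbors F ρ) k
  obtain ⟨S₀, hS₀⟩ := Infinite.exists_subset_card_eq ℚ (D₀ + 1)
  obtain ⟨x, hx⟩ := hD₀ ℚ S₀ (by omega)
  obtain ⟨M, hME, hMx⟩ := exists_matroid_of_vectors ℚ x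
  have hM : ∀ X : Finset E, M.Indep (X : Set E) ↔ X ∈ constructionIndepSets F k ρ :=
    fun X => by rw [hMx, hx, hiff]
  refine ⟨M, hME, hM, fun h_lt => ?_, ⟨?_, fun X _ => ?_⟩, ?_⟩
  · have hc := isConstructedMatroid_of_indep_iff h_union h_k h_inter h_lt hME hM
    exact ⟨hc, fun M' hM' => hc.eq hM',
      hc.exists_parameters h_union h_k h_inter h_lt hM⟩
  · rw [hME, ← Set.image_univ]
    exact Sum.inl_injective.injOn.bijOn_image
  · lift X to Finset E using X.toFinite
    rw [hM, image_mem_gammoidIndepSets_iff, hiff]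
  · obtain ⟨D, hD⟩ := exists_vectors_transversal.{u, u, w} (midNeighbors F ρ) k
    refine ⟨D + 1, fun K _ _ hK => ?_⟩
    have := Fintype.ofFinite K
    obtain ⟨y, hy⟩ := hD K univ (by rw [card_univ, ← Nat.card_eq_fintype_card]; omega)
    obtain ⟨C, hC⟩ := exists_code_of_vectors y hME fun X => by rw [hM, hiff, hy]
    exact ⟨C, hC, fun n k' d r δ h => hC.isLRC h⟩
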